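/- A cyclotomic integer is an algebraic integer that is a finite sum of roots of unity in $\mathbb{C}$. Its length is the smallest number $k$ such that it is a sum of $k$ (not necessarily distinct) roots of unity. Write $\zeta_n = e^{2\pi i/n}$ and $\mathbb{Q}_n = \mathbb{Q}(\zeta_n)$ for $n\ge 1$, and let the conductor $c(\alpha)$ of a cyclotomic integer $\alpha$ be the smallest positive integer $c$ with $\mathbb{Q}(\alpha) \subseteq \mathbb{Q}_c$. Theorem. Let $\alpha$ be a cyclotomic integer of length 4. Then $$[\mathbb{Q}_{c(\alpha)} : \mathbb{Q}(\alpha)] \le 6.$$ Moreover, equality holds if and only if $\alpha$ is of the form $$\alpha = \varepsilon\left(\zeta_6^{c} + \zeta_7^{a} + \zeta_7^{2a} + \zeta_7^{4a}\right),$$ where $c$ is an integer coprime to 6, $a$ is an integer coprime to 7, and $\varepsilon$ is a root of unity whose order is a multiple of 4 and is divisible by neither 3 nor 7. -/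

import Mathlib

open IntermediateField

/-- `ζ_n = e^{2πi/n}`, a primitive `n`-th root of unity when `n ≥ 1`. -/
noncomputable def zeta (n : ℕ) : ℂ := Complex.exp (2 * Real.pi * Complex.I / n)

/-- `ℚ_n = ℚ(ζ_n)`, as a subfield of `ℂ` (used for `n ≥ 1`). -/
noncomputable def cyclotomicSubfield (n : ℕ) : IntermediateField ℚ ℂ := ℚ⟮zeta n⟯

/-- `α` can be written as a sum of `k` roots of unity (not necessarily distinct), that is,
`α` has a representation of weight `k`.  A root of unity is an element of finite order. -/
def IsSumOfRootsOfUnity (α : ℂ) (k : ℕ) : Prop :=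
  ∃ f : Fin k → ℂ, (∀ i, IsOfFinOrder (f i)) ∧ α = ∑ i, f i

/-- A cyclotomic integer: an algebraic integer which is a sum of roots of unity. -/
def IsCyclotomicInteger (α : ℂ) : Prop :=
  IsIntegral ℤ α ∧ ∃ k : ℕ, IsSumOfRootsOfUnity α k

/-- The length of a cyclotomic integer: the least weight of a representation of `α` as a sum of
roots of unity. -/
noncomputable def cyclotomicLength (α : ℂ) : ℕ :=
  sInf {k : ℕ | IsSumOfRootsOfUnity α k}

/-- The conductor of a cyclotomic integer: the least positive integer `c` such that
`ℚ(α) ⊆ ℚ_c`. -/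
noncomputable def cyclotomicConductor (α : ℂ) : ℕ :=
  sInf {c : ℕ | 0 < c ∧ ℚ⟮α⟯ ≤ cyclotomicSubfield c}

/-- The degree `[ℚ_{c(α)} : ℚ(α)]`.  (`relfinrank A B` is `[B : A]` when `A ≤ B`; that
`ℚ(α) ≤ ℚ_{c(α)}` holds for cyclotomic integers is `cyclotomicConductor_spec` below.) -/
noncomputable def conductorDegree (α : ℂ) : ℕ :=
  relfinrank ℚ⟮α⟯ (cyclotomicSubfield (cyclotomicConductor α))

/-- The conductor of a cyclotomic integer is well defined. -/
theorem cyclotomicConductor_spec {α : ℂ} (h : IsCyclotomicInteger α) :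
    0 < cyclotomicConductor α ∧ ℚ⟮α⟯ ≤ cyclotomicSubfield (cyclotomicConductor α) := by
  obtain ⟨-, k, f, hf, rfl⟩ := h
  have hN : 0 < ∏ i, orderOf (f i) := Finset.prod_pos fun i _ => (hf i).orderOf_pos
  refine Nat.sInf_mem (s := {c : ℕ | 0 < c ∧ ℚ⟮∑ i, f i⟯ ≤ cyclotomicSubfield c})
    ⟨∏ i, orderOf (f i), hN, ?_⟩
  have : NeZero (∏ i, orderOf (f i)) := ⟨hN.ne'⟩
  rw [adjoin_simple_le_iff]
  refine sum_mem fun i _ => ?_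
  have hpow : f i ^ (∏ j, orderOf (f j)) = 1 :=
    orderOf_dvd_iff_pow_eq_one.mp (Finset.dvd_prod_of_mem _ (Finset.mem_univ i))
  obtain ⟨m, -, hm⟩ := (Complex.isPrimitiveRoot_exp _ hN.ne').eq_pow_of_pow_eq_one hpow
  rw [← hm]
  exact pow_mem (mem_adjoin_simple_self ℚ _) m

/-! A minimal representation of an element of `ℚ_m`, with `m` even, uses only `m`-th roots of unity
(`Reduced.pow_eq_one_of_sum_mem`). So the four roots of unity of a minimal representation `s` of `α`
have order dividing `N`, the even level of the conductor. The degree is the order of the stabiliser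
`H ≤ (ZMod N)ˣ` of `α`, acting by power maps, and minimality of the conductor says that only `1 ∈ H`
fixes every element of `s`.

For `k ∈ H`, both `s` and its image under `y ↦ y ^ k` are minimal representations of `α`; their
difference is a vanishing sum of eight roots of unity. Fourier inversion over cosets
(`exists_sum_filter_pow_eq`) shows that such a sum splits over the cosets of the `210`-th roots of
unity, and the question is whether it splits further over those of the `30`-th roots.

If it does for every `k`, then `H` has at most four elements (`card_le_four_of_splitting`). When
each coset meets `s` at most twice, minimal representations are unique coset by coset, so `H` is an
abelian group of permutations of at most four points. Otherwise three elements share a coset and `H`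
embeds into `(ZMod 30)ˣ`, of order `8`; surjectivity would give an element congruent to `7`, and its
action pushes that part of `s` into one coset of the sixth or tenth roots of unity, leaving too
little room.

If it fails for some `k`, the eight terms are the relation `1 + ξ + ⋯ + ξ ^ 6 = 0` with `1` replaced
by `-ω - ω ^ 2`, up to a factor `X` (`exists_septicForm_of_not_splitting`). Then `s` consists of
`-Xω` and of `Xξ` for three primitive seventh roots `ξ ∈ A`. An element of `H` either preserves `X`,
`ω`, `A`, or sends them to `-X`, `ω ^ 2` and the complement of `A`; hence `H` embeds into `(ZMod
7)ˣ`. If it has order `6`, the residue `2` must preserve `A`, giving `A = {ξ, ξ ^ 2, ξ ^ 4}`, and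
the residue `3` must exchange `A` with its complement; together they dictate the order of `X`.
Conversely the Chinese remainder theorem produces all six elements. -/

/-- A multiset of roots of unity having the least cardinality among those with its sum. -/
structure Reduced (s : Multiset ℂ) : Prop where
  isOfFinOrder : ∀ y ∈ s, IsOfFinOrder y
  card_le : ∀ t : Multiset ℂ, (∀ y ∈ t, IsOfFinOrder y) → t.sum = s.sum → s.card ≤ t.card

/-! ### Roots of unity and reduced representations. -/

theorem isOfFinOrder_ne_zero {x : ℂ} (hx : IsOfFinOrder x) : x ≠ 0 := by
  rintro rfl
  simpa using hx.norm_eq_one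

theorem isOfFinOrder_neg {x : ℂ} (hx : IsOfFinOrder x) : IsOfFinOrder (-x) := by
  obtain ⟨n, hn, h⟩ := isOfFinOrder_iff_pow_eq_one.1 hx
  refine isOfFinOrder_iff_pow_eq_one.2 ⟨2 * n, by omega, ?_⟩
  rw [pow_mul, neg_sq, ← pow_mul, mul_comm, pow_mul, h, one_pow]

theorem isOfFinOrder_inv {x : ℂ} (hx : IsOfFinOrder x) : IsOfFinOrder x⁻¹ := by
  obtain ⟨n, hn, h⟩ := isOfFinOrder_iff_pow_eq_one.1 hx
  exact isOfFinOrder_iff_pow_eq_one.2 ⟨n, hn, by rw [inv_pow, h, inv_one]⟩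

theorem isOfFinOrder_mul {x y : ℂ} (hx : IsOfFinOrder x) (hy : IsOfFinOrder y) :
    IsOfFinOrder (x * y) := (Commute.all x y).isOfFinOrder_mul hx hy

theorem isOfFinOrder_of_pow_eq_one {x : ℂ} {n : ℕ} (hn : 0 < n) (hx : x ^ n = 1) :
    IsOfFinOrder x := isOfFinOrder_iff_pow_eq_one.2 ⟨n, hn, hx⟩

theorem isOfFinOrder_of_pow_eq_pow {x y : ℂ} {n : ℕ} (hn : 0 < n) (hx : IsOfFinOrder x)
    (hy : y ^ n = x ^ n) : IsOfFinOrder y := by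
  have : IsOfFinOrder (y / x) := isOfFinOrder_of_pow_eq_one hn (by
    rw [div_pow, hy, div_self (pow_ne_zero _ (isOfFinOrder_ne_zero hx))])
  simpa [div_mul_cancel₀ _ (isOfFinOrder_ne_zero hx)] using isOfFinOrder_mul this hx

theorem conj_eq_inv_of_isOfFinOrder {x : ℂ} (hx : IsOfFinOrder x) : (starRingEnd ℂ) x = x⁻¹ := by
  rw [Complex.inv_def, Complex.normSq_eq_norm_sq, hx.norm_eq_one]; simp

namespace Reduced

variable {s t u : Multiset ℂ}

theorem card_eq (hs : Reduced s) (ht : Reduced t) (h : s.sum = t.sum) : s.card = t.card :=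
  le_antisymm (hs.card_le t ht.isOfFinOrder h.symm) (ht.card_le s hs.isOfFinOrder h)

theorem of_card_eq (hs : Reduced s) (ht : ∀ y ∈ t, IsOfFinOrder y) (h : t.sum = s.sum)
    (hc : t.card = s.card) : Reduced t :=
  ⟨ht, fun u hu hut => hc ▸ hs.card_le u hu (hut.trans h)⟩

theorem of_le (hs : Reduced s) (h : t ≤ s) : Reduced t := by
  refine ⟨fun y hy => hs.1 y (Multiset.mem_of_le h hy), fun u hu hut => ?_⟩
  obtain ⟨r, rfl⟩ := Multiset.le_iff_exists_add.1 h
  have := hs.card_le (u + r) (fun y hy => ?_) (by simp [hut])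
  · simpa using this
  · rcases Multiset.mem_add.1 hy with hy | hy
    · exact hu y hy
    · exact hs.1 y (by simp [hy])

theorem filter (hs : Reduced s) (p : ℂ → Prop) [DecidablePred p] : Reduced (s.filter p) :=
  hs.of_le (Multiset.filter_le _ _)

theorem eq_zero_of_sum_eq_zero (hs : Reduced s) (h : s.sum = 0) : s = 0 := by
  have := hs.card_le 0 (by simp) (by simp [h])
  simpa using this

theorem map_mul (hs : Reduced s) {x : ℂ} (hx : IsOfFinOrder x) : Reduced (s.map (x * ·)) := by
  have hx0 := isOfFinOrder_ne_zero hx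
  refine ⟨fun y hy => ?_, fun u hu hut => ?_⟩
  · obtain ⟨z, hz, rfl⟩ := Multiset.mem_map.1 hy
    exact isOfFinOrder_mul hx (hs.1 z hz)
  · have := hs.card_le (u.map (x⁻¹ * ·)) (fun y hy => ?_) ?_
    · simpa using this
    · obtain ⟨z, hz, rfl⟩ := Multiset.mem_map.1 hy
      exact isOfFinOrder_mul (isOfFinOrder_inv hx) (hu z hz)
    · rw [Multiset.sum_map_mul_left, Multiset.map_id', hut, Multiset.sum_map_mul_left,
        Multiset.map_id', inv_mul_cancel_left₀ hx0]

/-- A reduced multiset does not contain two elements whose sum is a root of unity. -/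
theorem add_not_isOfFinOrder (hs : Reduced s) {a b : ℂ} (h : {a, b} ≤ s) :
    ¬ IsOfFinOrder (a + b) := fun hab => by
  have := (hs.of_le h).card_le {a + b} (by simpa using hab) (by simp)
  simp at this

/-- A reduced representation of weight at most two is unique. -/
theorem unique_of_card_le_two (hs : Reduced s) (ht : Reduced t) (h : s.sum = t.sum)
    (hc : s.card ≤ 2) : s = t := by
  have hst := hs.card_eq ht h
  have h3 : s.card = 0 ∨ s.card = 1 ∨ s.card = 2 := by omega
  rcases h3 with h0 | h1 | h2
  · rw [h0] at hst
    rw [Multiset.card_eq_zero.1 h0, Multiset.card_eq_zero.1 hst.symm]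
  · rw [h1] at hst
    obtain ⟨a, rfl⟩ := Multiset.card_eq_one.1 h1
    obtain ⟨b, rfl⟩ := Multiset.card_eq_one.1 hst.symm
    simpa using h
  · rw [h2] at hst
    obtain ⟨a, b, rfl⟩ := Multiset.card_eq_two.1 h2
    obtain ⟨c, d, rfl⟩ := Multiset.card_eq_two.1 hst.symm
    have ha := hs.1 a (by simp)
    have hb := hs.1 b (by simp)
    have hc := ht.1 c (by simp)
    have hd := ht.1 d (by simp)
    have ha0 := isOfFinOrder_ne_zero ha
    have hb0 := isOfFinOrder_ne_zero hb
    have hc0 := isOfFinOrder_ne_zero hc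
    have hd0 := isOfFinOrder_ne_zero hd
    have h' : a + b = c + d := by simpa using h
    have hne : a + b ≠ 0 := fun h0 => by
      have := hs.eq_zero_of_sum_eq_zero (by simpa using h0)
      simp at this
    -- Conjugation inverts roots of unity, so a nonzero sum of two of them determines their product,
    -- and hence the pair as the roots of a quadratic.
    have hconj : a⁻¹ + b⁻¹ = c⁻¹ + d⁻¹ := by
      have := congrArg (starRingEnd ℂ) h'
      simpa [conj_eq_inv_of_isOfFinOrder, ha, hb, hc, hd] using this
    have hprod : a * b = c * d := by
      field_simp at hconj
      have h5 : (a + b) * (c * d - a * b) = 0 := by linear_combination hconj - a * b * h'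
      rcases mul_eq_zero.1 h5 with h6 | h6
      · exact absurd h6 hne
      · exact (sub_eq_zero.1 h6).symm
    have h7 : (a - c) * (a - d) = 0 := by linear_combination a * h' - hprod
    rcases mul_eq_zero.1 h7 with h8 | h8
    · obtain rfl := sub_eq_zero.1 h8
      rw [add_left_cancel h']
    · obtain rfl := sub_eq_zero.1 h8
      have : b = c := by linear_combination h'
      rw [this]; exact Multiset.pair_comm _ _

end Reduced

/-- If a root of unity `g` is the sum of two roots of unity, these are `-g * ω` and `-g * ω ^ 2`
for a primitive cube root of unity `ω`. -/
theorem exists_cubeRoot_of_add_eq {a b g : ℂ} (ha : IsOfFinOrder a) (hb : IsOfFinOrder b)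
    (hg : IsOfFinOrder g) (h : a + b = g) :
    ∃ ω : ℂ, IsPrimitiveRoot ω 3 ∧ a = -g * ω ∧ b = -g * ω ^ 2 := by
  have ha0 := isOfFinOrder_ne_zero ha
  have hb0 := isOfFinOrder_ne_zero hb
  have hg0 := isOfFinOrder_ne_zero hg
  have hconj : a⁻¹ + b⁻¹ = g⁻¹ := by
    have := congrArg (starRingEnd ℂ) h
    simpa [conj_eq_inv_of_isOfFinOrder, ha, hb, hg] using this
  have hprod : g ^ 2 = a * b := by
    field_simp at hconj
    linear_combination hconj - g * h
  have hω : (-(a / g)) ^ 2 + -(a / g) + 1 = 0 := by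
    field_simp
    linear_combination hprod + a * h
  refine ⟨-(a / g), ?_, by field_simp, ?_⟩
  · have h3 : (-(a / g)) ^ 3 = 1 := by linear_combination (-(a / g) - 1) * hω
    refine IsPrimitiveRoot.iff_orderOf.2 (orderOf_eq_prime h3 fun h1 => ?_)
    rw [h1] at hω
    norm_num at hω
  · field_simp
    linear_combination hprod + (a + g) * h

/-! ### Cyclotomic fields and power maps. -/

theorem zeta_isPrimitiveRoot {n : ℕ} (hn : 0 < n) : IsPrimitiveRoot (zeta n) n :=
  Complex.isPrimitiveRoot_exp n hn.ne'

theorem zeta_eq_pow {m n : ℕ} (hn : 0 < n) (h : m ∣ n) : zeta m = zeta n ^ (n / m) := by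
  obtain ⟨d, rfl⟩ := h
  have hm : 0 < m := Nat.pos_of_mul_pos_right hn
  have hd : 0 < d := Nat.pos_of_mul_pos_left hn
  rw [Nat.mul_div_cancel_left _ hm, zeta, zeta, ← Complex.exp_nat_mul]
  congr 1
  have : (m : ℂ) ≠ 0 := by exact_mod_cast hm.ne'
  have : (d : ℂ) ≠ 0 := by exact_mod_cast hd.ne'
  push_cast
  field_simp

theorem mem_cyclotomicSubfield_of_pow_eq_one {n : ℕ} (hn : 0 < n) {x : ℂ} (hx : x ^ n = 1) :
    x ∈ cyclotomicSubfield n := by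
  have : NeZero n := ⟨hn.ne'⟩
  obtain ⟨i, -, rfl⟩ := (zeta_isPrimitiveRoot hn).eq_pow_of_pow_eq_one hx
  exact pow_mem (mem_adjoin_simple_self ℚ _) i

theorem cyclotomicSubfield_mono {m n : ℕ} (hn : 0 < n) (h : m ∣ n) :
    cyclotomicSubfield m ≤ cyclotomicSubfield n := by
  rw [cyclotomicSubfield, adjoin_simple_le_iff, zeta_eq_pow hn h]
  exact pow_mem (mem_adjoin_simple_self ℚ _) _

theorem isIntegral_zeta {n : ℕ} (hn : 0 < n) : IsIntegral ℚ (zeta n) :=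
  ((zeta_isPrimitiveRoot hn).isIntegral hn).tower_top

theorem exists_aeval_of_mem_cyclotomicSubfield {n : ℕ} (hn : 0 < n) {a : ℂ}
    (ha : a ∈ cyclotomicSubfield n) : ∃ P : Polynomial ℚ, a = Polynomial.aeval (zeta n) P := by
  have h2 : a ∈ (ℚ⟮zeta n⟯).toSubalgebra := ha
  rw [adjoin_simple_toSubalgebra_of_isAlgebraic (isIntegral_zeta hn).isAlgebraic,
    Algebra.adjoin_singleton_eq_range_aeval] at h2
  obtain ⟨P, hP⟩ := h2
  exact ⟨P, hP.symm⟩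

/-- One polynomial serves all exponents `k` at once, so that a Galois automorphism can be replaced
by evaluation at another primitive root. -/
theorem exists_polynomial_sum_map_pow {n : ℕ} (hn : 0 < n) (t : Multiset ℂ)
    (ht : ∀ y ∈ t, y ^ n = 1) : ∃ P : Polynomial ℚ, ∀ k : ℕ,
      (t.map (· ^ k)).sum = Polynomial.aeval (zeta n ^ k) P := by
  have : NeZero n := ⟨hn.ne'⟩
  induction t using Multiset.induction with
  | empty => exact ⟨0, by simp⟩
  | cons y t ih =>
    obtain ⟨P, hP⟩ := ih fun z hz => ht z (Multiset.mem_cons_of_mem hz)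
    obtain ⟨i, -, hi⟩ := (zeta_isPrimitiveRoot hn).eq_pow_of_pow_eq_one
      (ht y (Multiset.mem_cons_self y t))
    refine ⟨Polynomial.X ^ i + P, fun k => ?_⟩
    rw [Multiset.map_cons, Multiset.sum_cons, hP, ← hi]
    simp [← pow_mul, mul_comm]

/-- Raising roots of unity of order dividing `n` to a power `k` prime to `n` and congruent to `1`
modulo `m` does not change their sum if it lies in `ℚ_m`. -/
theorem sum_map_pow_eq_sum {m n k : ℕ} (hn : 0 < n) (hmn : m ∣ n) (hk : k.Coprime n)
    (hkm : k ≡ 1 [MOD m]) {t : Multiset ℂ} (ht : ∀ y ∈ t, y ^ n = 1)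
    (hs : t.sum ∈ cyclotomicSubfield m) : (t.map (· ^ k)).sum = t.sum := by
  have hm : 0 < m := Nat.pos_of_dvd_of_pos hmn hn
  obtain ⟨P, hP⟩ := exists_polynomial_sum_map_pow hn t ht
  obtain ⟨Q, hQ⟩ := exists_aeval_of_mem_cyclotomicSubfield hm hs
  have hz := zeta_isPrimitiveRoot hn
  have h1 : Polynomial.aeval (zeta n) (P - Q.comp (Polynomial.X ^ (n / m))) = 0 := by
    have := hP 1
    simp only [pow_one, Multiset.map_id'] at this
    rw [map_sub, ← this, Polynomial.aeval_comp, hQ, Polynomial.aeval_X_pow, ← zeta_eq_pow hn hmn,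
      sub_self]
  -- A rational polynomial vanishing at `zeta n` is divisible by the cyclotomic polynomial, which
  -- also vanishes at `zeta n ^ k`.
  have h2 : Polynomial.aeval (zeta n ^ k) (P - Q.comp (Polynomial.X ^ (n / m))) = 0 := by
    rw [← minpoly.dvd_iff, ← Polynomial.cyclotomic_eq_minpoly_rat hz hn] at h1
    obtain ⟨R, hR⟩ := h1
    rw [hR, Polynomial.cyclotomic_eq_minpoly_rat (hz.pow_of_coprime k hk) hn, map_mul,
      minpoly.aeval, zero_mul]
  have h3 : (zeta n ^ k) ^ (n / m) = zeta m := by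
    rw [← pow_mul, mul_comm, pow_mul, ← zeta_eq_pow hn hmn]
    have h4 : zeta m ^ k = zeta m ^ 1 :=
      pow_eq_pow_of_modEq hkm (zeta_isPrimitiveRoot hm).pow_eq_one
    rwa [pow_one] at h4
  rw [map_sub, Polynomial.aeval_comp, Polynomial.aeval_X_pow, h3, ← hQ, ← hP, sub_eq_zero] at h2
  exact h2

/-! ### Fourier inversion over cosets of roots of unity. -/

theorem sum_range_pow_of_pow_eq_one {p : ℕ} {w : ℂ} (hw : w ^ p = 1) :
    ∑ j ∈ Finset.range p, w ^ j = if w = 1 then (p : ℂ) else 0 := by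
  split_ifs with h
  · simp [h]
  · have := mul_neg_geom_sum w p
    rw [hw, sub_self] at this
    exact (mul_eq_zero.1 this).resolve_left (sub_ne_zero.2 (Ne.symm h))

theorem Multiset.sum_filter_eq_sum_map_ite (t : Multiset ℂ) (q : ℂ → Prop) [DecidablePred q] :
    (t.filter q).sum = (t.map fun y => if q y then y else 0).sum := by
  induction t using Multiset.induction with
  | empty => simp
  | cons y t ih => by_cases h : q y <;> simp [h, ih]

/-- Fourier inversion for the classes of roots of unity modulo those of order dividing `m`. -/
theorem mul_sum_filter_pow_eq {p m : ℕ} {x : ℂ} (hx : x ^ (p * m) = 1)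
    (hpm : 0 < p * m) {t : Multiset ℂ} (ht : ∀ y ∈ t, y ^ (p * m) = 1) :
    p * (t.filter fun y => y ^ m = x ^ m).sum =
      x * ∑ j ∈ Finset.range p, x⁻¹ ^ (1 + m * j) * (t.map (· ^ (1 + m * j))).sum := by
  have hx0 : x ≠ 0 := by rintro rfl; simp [zero_pow hpm.ne'] at hx
  rw [Multiset.sum_filter_eq_sum_map_ite, ← Multiset.sum_map_mul_left]
  simp_rw [← Multiset.sum_map_mul_left]
  rw [← Multiset.sum_map_sum, ← Multiset.sum_map_mul_left]
  refine congrArg _ (Multiset.map_congr rfl fun y hy => ?_)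
  have h1 : ∀ j, x⁻¹ ^ (1 + m * j) * y ^ (1 + m * j) = x⁻¹ * y * ((x⁻¹ * y) ^ m) ^ j := fun j => by
    rw [← mul_pow, pow_add, pow_one, pow_mul]
  have h2 : (x⁻¹ * y) ^ m = 1 ↔ y ^ m = x ^ m := by
    rw [mul_pow, inv_pow, inv_mul_eq_one₀ (pow_ne_zero _ hx0)]
    exact eq_comm
  rw [Finset.sum_congr rfl fun j _ => h1 j, ← Finset.mul_sum, sum_range_pow_of_pow_eq_one]
  · by_cases h : y ^ m = x ^ m
    · rw [if_pos h, if_pos (h2.2 h)]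
      field_simp
    · rw [if_neg h, if_neg (h2.not.2 h)]
      simp
  · rw [← pow_mul, mul_pow, inv_pow, mul_comm m, hx, ht y hy]; simp

/-- When `p ∣ m`, every exponent `1 + m * j` is prime to `p * m` and congruent to `1` modulo `m`.
All the power sums therefore equal `t.sum`, and the Fourier sum becomes a geometric series. -/
theorem sum_filter_pow_eq_of_dvd {p m : ℕ} (hp : p.Prime) (hm : 0 < m) (hpm : p ∣ m)
    {t : Multiset ℂ} (ht : ∀ y ∈ t, y ^ (p * m) = 1) (hs : t.sum ∈ cyclotomicSubfield m)
    {x : ℂ} (hx : x ^ (p * m) = 1) :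
    (t.filter fun y => y ^ m = x ^ m).sum = if x ^ m = 1 then t.sum else 0 := by
  have hp0 : (p : ℂ) ≠ 0 := by exact_mod_cast hp.ne_zero
  have hx0 : x ≠ 0 := by
    rintro rfl
    simp [hp.ne_zero, hm.ne'] at hx
  have h1 := mul_sum_filter_pow_eq hx (Nat.mul_pos hp.pos hm) ht
  have h2 : ∀ j ∈ Finset.range p, x⁻¹ ^ (1 + m * j) * (t.map (· ^ (1 + m * j))).sum =
      x⁻¹ * t.sum * ((x⁻¹) ^ m) ^ j := fun j _ => by
    rw [sum_map_pow_eq_sum (n := p * m) (m := m) (Nat.mul_pos hp.pos hm) (Dvd.intro_left _ rfl)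
      ?_ ?_ ht hs, pow_add, pow_one, pow_mul]
    · ring
    · refine Nat.Coprime.mul_right ?_ (by simp)
      obtain ⟨d, rfl⟩ := hpm
      rw [mul_assoc]; simp
    · simp [Nat.ModEq]
  rw [Finset.sum_congr rfl h2, ← Finset.mul_sum, sum_range_pow_of_pow_eq_one] at h1
  · simp only [inv_pow, inv_eq_one] at h1
    split_ifs at h1 ⊢ with h
    · apply mul_left_cancel₀ hp0
      rw [h1]; field_simp
    · simpa [hp0] using h1
  · rw [← pow_mul, mul_comm m, inv_pow, hx, inv_one]

/-- When `p ∤ m`, exactly one exponent `1 + m * j` with `j < p` is divisible by `p`; the others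
leave `t.sum` unchanged. With coset representatives that are `p`-th roots of unity, the exceptional
exponent contributes the same constant `c` for every coset. -/
theorem exists_sum_filter_pow_eq {p m : ℕ} (hp : p.Prime) (hm : 0 < m) (hpm : ¬ p ∣ m)
    {t : Multiset ℂ} (ht : ∀ y ∈ t, y ^ (p * m) = 1) (hs : t.sum ∈ cyclotomicSubfield m) :
    ∃ c : ℂ, ∀ x : ℂ, x ^ p = 1 →
      (t.filter fun y => y ^ m = x ^ m).sum = x * (c + if x = 1 then t.sum else 0) := by
  have hp0 : (p : ℂ) ≠ 0 := by exact_mod_cast hp.ne_zero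
  have hcop : m.Coprime p := ((Nat.Prime.coprime_iff_not_dvd hp).2 hpm).symm
  -- The exceptional index is `-m⁻¹` modulo `p`.
  obtain ⟨j₀, hj₀, hj₀'⟩ : ∃ j₀ < p, p ∣ 1 + m * j₀ := by
    obtain ⟨v, -, hv⟩ := Nat.exists_mul_mod_eq_one_of_coprime hcop hp.one_lt
    refine ⟨((p - 1) * v) % p, Nat.mod_lt _ hp.pos, ?_⟩
    rw [Nat.dvd_iff_mod_eq_zero, Nat.add_mod, Nat.mul_mod, Nat.mod_mod, ← Nat.mul_mod,
      mul_left_comm, Nat.mul_mod, hv, mul_one, Nat.mod_mod, ← Nat.add_mod, add_comm,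
      Nat.sub_add_cancel hp.one_le, Nat.mod_self]
  refine ⟨((t.map (· ^ (1 + m * j₀))).sum - t.sum) / p, fun x hxp => ?_⟩
  have hx0 : x ≠ 0 := by
    rintro rfl
    simp [hp.ne_zero] at hxp
  have hx : x ^ (p * m) = 1 := by rw [pow_mul, hxp, one_pow]
  have h1 := mul_sum_filter_pow_eq hx (Nat.mul_pos hp.pos hm) ht
  have hj1 : x⁻¹ ^ (1 + m * j₀) = 1 := by
    obtain ⟨d, hd⟩ := hj₀'
    rw [hd, pow_mul, inv_pow, hxp, inv_one, one_pow]
  have h2 : ∀ j ∈ Finset.range p, x⁻¹ ^ (1 + m * j) * (t.map (· ^ (1 + m * j))).sum =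
      x⁻¹ * t.sum * ((x⁻¹) ^ m) ^ j +
        if j = j₀ then (t.map (· ^ (1 + m * j₀))).sum - t.sum else 0 := fun j hj => by
    have h3 : x⁻¹ * t.sum * ((x⁻¹) ^ m) ^ j = x⁻¹ ^ (1 + m * j) * t.sum := by
      rw [pow_add, pow_one, pow_mul]; ring
    rw [h3]
    split_ifs with hjj
    · subst hjj
      rw [hj1]; ring
    · rw [sum_map_pow_eq_sum (n := p * m) (m := m) (Nat.mul_pos hp.pos hm) (Dvd.intro_left _ rfl)
        ?_ ?_ ht hs, add_zero]
      · refine Nat.Coprime.mul_right ?_ (by simp)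
        refine ((Nat.Prime.coprime_iff_not_dvd hp).2 fun hd => hjj ?_).symm
        have h4 : 1 + m * j ≡ 1 + m * j₀ [MOD p] :=
          ((Nat.modEq_zero_iff_dvd.2 hd).trans (Nat.modEq_zero_iff_dvd.2 hj₀').symm)
        have h5 := Nat.ModEq.cancel_left_of_coprime (by simpa using hcop.symm)
          (Nat.ModEq.add_left_cancel' 1 h4)
        exact Nat.ModEq.eq_of_lt_of_lt h5 (Finset.mem_range.1 hj) hj₀
      · simp [Nat.ModEq]
  rw [Finset.sum_congr rfl h2, Finset.sum_add_distrib, ← Finset.mul_sum,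
    sum_range_pow_of_pow_eq_one, Finset.sum_ite_eq', if_pos (Finset.mem_range.2 hj₀)] at h1
  · have h3 : x⁻¹ ^ m = 1 ↔ x = 1 := by
      constructor
      · intro h
        rw [inv_pow, inv_eq_one] at h
        have := pow_gcd_eq_one.2 ⟨h, hxp⟩
        rwa [hcop.gcd_eq_one, pow_one] at this
      · rintro rfl; simp
    apply mul_left_cancel₀ hp0
    rw [h1]
    by_cases hx1 : x = 1
    · rw [if_pos hx1, if_pos (h3.2 hx1)]; field_simp; subst hx1; ring
    · rw [if_neg hx1, if_neg (h3.not.2 hx1)]; field_simp; ring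
  · rw [← pow_mul, mul_comm m, inv_pow, hx, inv_one]

theorem exists_pow_eq_pow_of_pow_mul_eq_one {p m : ℕ} (hp : p.Prime) (hpm : ¬ p ∣ m) {y : ℂ}
    (hy : y ^ (p * m) = 1) : ∃ η : ℂ, η ^ p = 1 ∧ y ^ m = η ^ m := by
  have hcop : m.Coprime p := ((Nat.Prime.coprime_iff_not_dvd hp).2 hpm).symm
  obtain ⟨v, -, hv⟩ := Nat.exists_mul_mod_eq_one_of_coprime hcop hp.one_lt
  refine ⟨y ^ (m * v), ?_, ?_⟩
  · rw [← pow_mul, mul_right_comm, mul_comm m, pow_mul, hy, one_pow]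
  · rw [← pow_mul, mul_comm _ m, pow_mul]
    have : m * v ≡ 1 [MOD p] := by rw [Nat.ModEq, hv, Nat.mod_eq_of_lt hp.one_lt]
    rw [pow_eq_pow_of_modEq this (by rw [← pow_mul, mul_comm, hy]), pow_one]

theorem eq_one_of_pow_eq_one_of_prime {p m : ℕ} (hp : p.Prime) (hpm : ¬ p ∣ m) {x : ℂ}
    (hx : x ^ p = 1) (hxm : x ^ m = 1) : x = 1 := by
  have := pow_gcd_eq_one.2 ⟨hx, hxm⟩
  rwa [((Nat.Prime.coprime_iff_not_dvd hp).2 hpm).gcd_eq_one, pow_one] at this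

theorem eq_of_pow_eq_pow_of_prime {p m : ℕ} (hp : p.Prime) (hpm : ¬ p ∣ m) {x y : ℂ}
    (hx : x ^ p = 1) (hy : y ^ p = 1) (hxm : x ^ m = y ^ m) : x = y := by
  have hy0 : y ≠ 0 := by rintro rfl; simp [hp.ne_zero] at hy
  have := eq_one_of_pow_eq_one_of_prime hp hpm (x := x / y) (by rw [div_pow, hx, hy, div_one])
    (by rw [div_pow, hxm, div_self (pow_ne_zero _ hy0)])
  rwa [div_eq_one_iff_eq hy0] at this

/-! ### Decomposing a multiset into fibres. -/

section Fibers

variable {α β ι : Type*} [DecidableEq β]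

theorem Multiset.sum_filter_fiber_le (s : Multiset α) (f : α → β) (C : Finset ι) (g : ι → β)
    (hg : Set.InjOn g C) : ∑ i ∈ C, s.filter (fun y => f y = g i) ≤ s := by
  classical
  rw [Multiset.le_iff_count]
  intro a
  rw [Multiset.count_sum']
  simp_rw [Multiset.count_filter]
  by_cases h : ∃ i ∈ C, f a = g i
  · obtain ⟨i, hi, h⟩ := h
    rw [Finset.sum_eq_single_of_mem i hi fun j hj hji => if_neg fun h' =>
      hji (hg hj hi (h'.symm.trans h)), if_pos h]
  · push Not at h
    rw [Finset.sum_eq_zero fun i hi => if_neg (h i hi)]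
    exact Nat.zero_le _

theorem Multiset.sum_filter_fiber_eq (s : Multiset α) (f : α → β) (C : Finset ι) (g : ι → β)
    (hg : Set.InjOn g C) (hs : ∀ y ∈ s, ∃ i ∈ C, f y = g i) :
    ∑ i ∈ C, s.filter (fun y => f y = g i) = s := by
  classical
  refine le_antisymm (s.sum_filter_fiber_le f C g hg) ?_
  rw [Multiset.le_iff_count]
  intro a
  by_cases ha : a ∈ s
  · obtain ⟨i, hi, h⟩ := hs a ha
    rw [Multiset.count_sum']
    simp_rw [Multiset.count_filter]
    rw [Finset.sum_eq_single_of_mem i hi fun j hj hji => if_neg fun h' =>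
      hji (hg hj hi (h'.symm.trans h)), if_pos h]
  · simp [Multiset.count_eq_zero_of_notMem ha]

end Fibers

/-! ### The level of a reduced representation. -/

namespace Reduced

variable {s : Multiset ℂ}

/-- If the sum of a reduced multiset of `p * m`-th roots of unity lies in `ℚ_m`, then its elements
are `m`-th roots of unity. -/
theorem pow_eq_one_of_sum_mem_of_prime (hs : Reduced s) {p m : ℕ} (hp : p.Prime) (hm : 0 < m)
    (h2 : 2 ∣ m) (ht : ∀ y ∈ s, y ^ (p * m) = 1) (hsum : s.sum ∈ cyclotomicSubfield m) :
    ∀ y ∈ s, y ^ m = 1 := by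
  intro y hy
  by_contra hne
  by_cases hpm : p ∣ m
  · have h := sum_filter_pow_eq_of_dvd hp hm hpm ht hsum (ht y hy)
    rw [if_neg hne] at h
    have := (hs.filter _).eq_zero_of_sum_eq_zero h
    rw [Multiset.filter_eq_nil] at this
    exact this y hy rfl
  · obtain ⟨c, hc⟩ := exists_sum_filter_pow_eq hp hm hpm ht hsum
    obtain ⟨η, hη, hyη⟩ := exists_pow_eq_pow_of_pow_mul_eq_one hp hpm (ht y hy)
    have hη1 : η ≠ 1 := by rintro rfl; exact hne (by rw [hyη, one_pow])
    have hη0 : η ≠ 0 := by rintro rfl; simp [hp.ne_zero] at hη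
    -- As `m` is even and `p ∤ m`, the prime `p` is odd, so `1`, `η`, `η ^ 2` represent three
    -- different cosets.
    have hp2 : ¬ p ∣ 2 := fun h => hpm (h.trans h2)
    have hηη : η ^ 2 ≠ 1 := fun h => hη1 (eq_one_of_pow_eq_one_of_prime hp hp2 hη h)
    have hη2 : (η ^ 2) ^ p = 1 := by rw [← pow_mul, mul_comm, pow_mul, hη, one_pow]
    have e1 := hc 1 (one_pow _)
    have e2 := hc η hη
    have e3 := hc (η ^ 2) hη2
    rw [if_neg hη1, add_zero] at e2
    rw [if_neg hηη, add_zero] at e3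
    rw [if_pos rfl, one_mul] at e1
    have hc0 : c ≠ 0 := by
      rintro rfl
      have := (hs.filter _).eq_zero_of_sum_eq_zero (e2.trans (mul_zero _))
      rw [Multiset.filter_eq_nil] at this
      exact this y hy hyη
    have hpos : 0 < (s.filter fun y => y ^ m = (η ^ 2) ^ m).card := by
      rw [Multiset.card_pos]
      intro h
      rw [h, Multiset.sum_zero, eq_comm] at e3
      exact mul_ne_zero (pow_ne_zero 2 hη0) hc0 e3
    have hle := Multiset.card_le_card (s.sum_filter_fiber_le (fun y => y ^ m)
      ({1, η, η ^ 2} : Finset ℂ) (fun x => x ^ m) (fun a ha b hb hab =>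
        eq_of_pow_eq_pow_of_prime hp hpm ?_ ?_ hab))
    · have hd1 : η ≠ η ^ 2 := fun h => hη1 (mul_left_cancel₀ hη0 (by rw [mul_one, ← pow_two, ← h]))
      rw [Finset.sum_insert (by simp [hη1.symm, hηη.symm]), Finset.sum_insert (by simp [hd1]),
        Finset.sum_singleton, Multiset.card_add, Multiset.card_add] at hle
      -- The coset sums are `c + s.sum`, `η * c` and `η ^ 2 * c`. Subtracting `c` from the first by
      -- means of the second recovers `s.sum` without the nonempty third coset, which contradicts
      -- minimality.
      have := hs.card_le (s.filter (fun y => y ^ m = 1 ^ m) +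
        (s.filter (fun y => y ^ m = η ^ m)).map (-η⁻¹ * ·)) ?_ ?_
      · rw [Multiset.card_add, Multiset.card_map] at this
        omega
      · intro z hz
        rcases Multiset.mem_add.1 hz with hz | hz
        · exact hs.1 z (Multiset.mem_filter.1 hz).1
        · obtain ⟨w, hw, rfl⟩ := Multiset.mem_map.1 hz
          exact isOfFinOrder_mul (isOfFinOrder_neg (isOfFinOrder_inv
            (isOfFinOrder_of_pow_eq_one hp.pos hη))) (hs.1 w (Multiset.mem_filter.1 hw).1)
      · rw [Multiset.sum_add, e1, Multiset.sum_map_mul_left, Multiset.map_id', e2]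
        field_simp; ring
    · simp only [Finset.coe_insert, Finset.coe_singleton, Set.mem_insert_iff,
        Set.mem_singleton_iff] at ha
      rcases ha with rfl | rfl | rfl <;> simp [hη, hη2]
    · simp only [Finset.coe_insert, Finset.coe_singleton, Set.mem_insert_iff,
        Set.mem_singleton_iff] at hb
      rcases hb with rfl | rfl | rfl <;> simp [hη, hη2]

/-- Start from the product of the orders and remove one prime at a time; the sum lies in all the
intermediate fields because they contain `ℚ_m`. -/
theorem pow_eq_one_of_sum_mem (hs : Reduced s) {m : ℕ} (hm : 0 < m) (h2 : 2 ∣ m)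
    (hsum : s.sum ∈ cyclotomicSubfield m) : ∀ y ∈ s, y ^ m = 1 := by
  suffices H : ∀ d : ℕ, 0 < d → (∀ y ∈ s, y ^ (d * m) = 1) → ∀ y ∈ s, y ^ m = 1 by
    refine H (s.map orderOf).prod ?_ fun y hy => ?_
    · rw [Nat.pos_iff_ne_zero, Ne, Multiset.prod_eq_zero_iff]
      rintro h
      obtain ⟨y, hy, h0⟩ := Multiset.mem_map.1 h
      exact (hs.1 y hy).orderOf_pos.ne' h0
    · exact orderOf_dvd_iff_pow_eq_one.1
        ((Multiset.dvd_prod (Multiset.mem_map_of_mem orderOf hy)).mul_right m)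
  intro d
  induction d using Nat.strong_induction_on with
  | _ d ih =>
    intro hd h
    rcases Nat.lt_or_ge 1 d with h1 | h1
    · obtain ⟨p, hp, e, rfl⟩ := Nat.exists_prime_and_dvd h1.ne'
      have he : 0 < e := Nat.pos_of_mul_pos_left hd
      refine ih e ((lt_mul_iff_one_lt_left he).2 hp.one_lt) he ?_
      refine hs.pow_eq_one_of_sum_mem_of_prime hp (Nat.mul_pos he hm) (h2.mul_left _) ?_ ?_
      · simpa only [mul_assoc] using h
      · exact cyclotomicSubfield_mono (Nat.mul_pos he hm) (Dvd.intro_left _ rfl) hsum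
    · obtain rfl : d = 1 := by omega
      simpa using h

end Reduced

/-! ### The conductor and the stabiliser. -/

theorem exists_reduced_of_cyclotomicLength {α : ℂ} {n : ℕ} (hα : IsCyclotomicInteger α)
    (hlen : cyclotomicLength α = n) : ∃ s : Multiset ℂ, Reduced s ∧ s.card = n ∧ s.sum = α := by
  have hmem : IsSumOfRootsOfUnity α n := by
    have := Nat.sInf_mem (s := {k : ℕ | IsSumOfRootsOfUnity α k}) hα.2
    rw [cyclotomicLength] at hlen
    rwa [hlen] at this
  obtain ⟨f, hf, rfl⟩ := hmem
  refine ⟨Finset.univ.val.map f, ⟨fun y hy => ?_, fun t ht hts => ?_⟩, by simp, rfl⟩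
  · obtain ⟨i, -, rfl⟩ := Multiset.mem_map.1 hy
    exact hf i
  · rw [Multiset.card_map, Finset.card_val, Finset.card_univ, Fintype.card_fin, ← hlen]
    refine Nat.sInf_le ?_
    refine ⟨fun i => t.toList.get (i.cast (by simp)), fun i => ht _ ?_, ?_⟩
    · rw [← Multiset.mem_toList]; exact List.get_mem _ _
    · rw [← Finset.sum_map_val, ← hts]
      conv_lhs => rw [← Multiset.coe_toList t]
      rw [Multiset.sum_coe, ← List.sum_ofFn]
      congr 1
      apply List.ext_get <;> simp

/-- The least even multiple of `n`, which defines the same cyclotomic field. -/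
def evenLevel (n : ℕ) : ℕ := if Even n then n else 2 * n

theorem two_dvd_evenLevel (n : ℕ) : 2 ∣ evenLevel n := by
  rw [evenLevel]; split_ifs with h
  · exact h.two_dvd
  · exact Dvd.intro _ rfl

theorem evenLevel_pos {n : ℕ} (hn : 0 < n) : 0 < evenLevel n := by
  rw [evenLevel]; split_ifs <;> omega

theorem cyclotomicSubfield_evenLevel {n : ℕ} (hn : 0 < n) :
    cyclotomicSubfield (evenLevel n) = cyclotomicSubfield n := by
  rw [evenLevel]; split_ifs with h
  · rfl
  refine le_antisymm ?_ (cyclotomicSubfield_mono (by omega) (Dvd.intro_left _ rfl))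
  obtain ⟨m, rfl⟩ := Nat.not_even_iff_odd.1 h
  rw [cyclotomicSubfield, adjoin_simple_le_iff]
  have hz := zeta_isPrimitiveRoot (n := 2 * (2 * m + 1)) (by omega)
  have h1 : zeta (2 * m + 1) = zeta (2 * (2 * m + 1)) ^ 2 := by
    rw [zeta_eq_pow (m := 2 * m + 1) (n := 2 * (2 * m + 1)) (by omega) (Dvd.intro_left _ rfl)]
    simp
  have h2 : zeta (2 * (2 * m + 1)) ^ (2 * m + 1) = -1 :=
    (hz.pow (by omega) (mul_comm _ _)).eq_neg_one_of_two_right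
  have h3 : zeta (2 * (2 * m + 1)) = -zeta (2 * m + 1) ^ (m + 1) := by
    rw [h1, ← pow_mul, show 2 * (m + 1) = (2 * m + 1) + 1 by ring, pow_succ, h2]; ring
  rw [h3]
  exact neg_mem (pow_mem (mem_adjoin_simple_self ℚ _) _)

section Conductor

variable {α : ℂ} {s : Multiset ℂ}

/-- The even level is needed because signs can occur when the conductor is odd: `-1` has conductor
`1`. -/
theorem pow_evenLevel_conductor_eq_one (hα : IsCyclotomicInteger α) (hs : Reduced s)
    (hsα : s.sum = α) : ∀ y ∈ s, y ^ evenLevel (cyclotomicConductor α) = 1 := by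
  obtain ⟨hc, hle⟩ := cyclotomicConductor_spec hα
  refine hs.pow_eq_one_of_sum_mem (evenLevel_pos hc) (two_dvd_evenLevel _) ?_
  rw [cyclotomicSubfield_evenLevel hc, hsα]
  exact hle (mem_adjoin_simple_self ℚ α)

/-- If `k` fixes every element, these are roots of unity of order dividing `d = gcd (k - 1, N)`,
where `N` is the even level. So `α ∈ ℚ_d`, and minimality of the conductor forces `d = N`. -/
theorem modEq_one_of_pow_eq_self (hα : IsCyclotomicInteger α) (hs : Reduced s) (hsα : s.sum = α)
    {k : ℕ} (hk : k.Coprime (evenLevel (cyclotomicConductor α))) (h : ∀ y ∈ s, y ^ k = y) :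
    k ≡ 1 [MOD evenLevel (cyclotomicConductor α)] := by
  obtain ⟨hc, -⟩ := cyclotomicConductor_spec hα
  have hN := pow_evenLevel_conductor_eq_one hα hs hsα
  have h2 := two_dvd_evenLevel (cyclotomicConductor α)
  have hNpos := evenLevel_pos hc
  have hkodd : ¬ 2 ∣ k := fun hd => by
    have := Nat.dvd_gcd hd h2
    rw [hk.gcd_eq_one] at this
    omega
  have hd2 := Nat.dvd_gcd (show 2 ∣ k - 1 by omega) h2
  have hdN := Nat.gcd_dvd_right (k - 1) (evenLevel (cyclotomicConductor α))
  have hdk := Nat.gcd_dvd_left (k - 1) (evenLevel (cyclotomicConductor α))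
  have hdpos := Nat.pos_of_dvd_of_pos hdN hNpos
  have hsd : ∀ y ∈ s, y ^ Nat.gcd (k - 1) (evenLevel (cyclotomicConductor α)) = 1 := by
    intro y hy
    refine pow_gcd_eq_one.2 ⟨?_, hN y hy⟩
    have hy0 := isOfFinOrder_ne_zero (hs.1 y hy)
    apply mul_left_cancel₀ hy0
    rw [← pow_succ', Nat.sub_add_cancel (by omega), h y hy, mul_one]
  have hcd : cyclotomicConductor α ≤ Nat.gcd (k - 1) (evenLevel (cyclotomicConductor α)) := by
    refine Nat.sInf_le ⟨hdpos, ?_⟩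
    rw [adjoin_simple_le_iff]
    have := multiset_sum_mem s fun y hy => mem_cyclotomicSubfield_of_pow_eq_one hdpos (hsd y hy)
    rwa [hsα] at this
  have hdeq : Nat.gcd (k - 1) (evenLevel (cyclotomicConductor α)) =
      evenLevel (cyclotomicConductor α) := by
    generalize Nat.gcd (k - 1) (evenLevel (cyclotomicConductor α)) = d at *
    generalize cyclotomicConductor α = c at *
    rw [evenLevel] at *
    split_ifs at * with he
    · exact Nat.dvd_antisymm hdN ((Nat.le_antisymm hcd (Nat.le_of_dvd hc hdN)) ▸ dvd_rfl)
    · obtain ⟨q, hq⟩ := hdN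
      rw [even_iff_two_dvd] at he
      have hq2 : q ≤ 2 := by
        by_contra hlt
        have : d * 3 ≤ d * q := Nat.mul_le_mul_left d (by omega)
        omega
      interval_cases q
      · omega
      · omega
      -- For an odd conductor `c` the remaining possibility `d = c` fails by parity: `k` is odd, so
      -- `d` is even.
      · exact absurd ((by omega : c = d) ▸ hd2) he
  rw [hdeq] at hdk
  exact ((Nat.modEq_iff_dvd' (by omega)).2 hdk).symm

/-- `H` corresponds to the subgroup fixing `ℚ⟮a⟯` under the isomorphism of the Galois group with
`(ZMod N)ˣ`. Galois theory is applied to an abstract `K`, and the degree is transported to `ℂ` along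
`φ`. -/
theorem exists_subgroup_card_eq_relfinrank {K : Type*} [Field K] [CharZero K] {N : ℕ} [NeZero N]
    [IsCyclotomicExtension {N} ℚ K] (φ : K →ₐ[ℚ] ℂ) (a : K) (t : Multiset K)
    (ht : ∀ y ∈ t, y ^ N = 1) (hta : t.sum = a) : ∃ H : Subgroup (ZMod N)ˣ,
      Nat.card H = relfinrank ℚ⟮φ a⟯ φ.fieldRange ∧
        ∀ k, k ∈ H ↔ (t.map (· ^ k.val.val)).sum = a := by
  have hnf : NumberField K := IsCyclotomicExtension.numberField {N} ℚ _
  have hgal : IsGalois ℚ K := IsCyclotomicExtension.isGalois {N} ℚ _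
  let e := IsCyclotomicExtension.Rat.galEquivZMod N K
  have hmap : ℚ⟮a⟯.map φ = ℚ⟮φ a⟯ := by
    rw [adjoin_map, Set.image_singleton]
  have hfin : relfinrank ℚ⟮φ a⟯ φ.fieldRange = Module.finrank ℚ⟮a⟯ K := by
    rw [← relfinrank_top_right, ← relfinrank_map_map ℚ⟮a⟯ ⊤ φ, hmap, ← AlgHom.fieldRange_eq_map]
  refine ⟨ℚ⟮a⟯.fixingSubgroup.map e.toMonoidHom, ?_, fun k => ?_⟩
  · rw [Nat.card_congr (ℚ⟮a⟯.fixingSubgroup.equivMapOfInjective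
      e.toMonoidHom e.injective).toEquiv.symm, IsGalois.card_fixingSubgroup_eq_finrank, hfin]
  · have hk : k ∈ ℚ⟮a⟯.fixingSubgroup.map e.toMonoidHom ↔ e.symm k ∈ ℚ⟮a⟯.fixingSubgroup :=
      Subgroup.mem_map_equiv
    have hfix : e.symm k ∈ ℚ⟮a⟯.fixingSubgroup ↔ e.symm k a = a := by
      rw [IntermediateField.mem_fixingSubgroup_iff]
      have := forall_mem_adjoin_smul_eq_self_iff ℚ (S := {a}) (e.symm k)
      simpa using this
    have key : e.symm k a = (t.map (· ^ k.val.val)).sum := by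
      rw [← hta, map_multiset_sum]
      refine congrArg _ (Multiset.map_congr rfl fun y hy => ?_)
      rw [IsCyclotomicExtension.Rat.galEquivZMod_apply_of_pow_eq N K (e.symm k) (ht y hy)]
      change y ^ (e (e.symm k)).val.val = _
      rw [MulEquiv.apply_symm_apply]
    rw [hk, hfix, ← key]

/-- The degree `[ℚ_{c(α)} : ℚ(α)]` is the order of the stabiliser of `α` in the Galois group of
the cyclotomic field, which acts on the roots of unity by powers. -/
theorem exists_subgroup_card_eq_conductorDegree (hα : IsCyclotomicInteger α) (hs : Reduced s)
    (hsα : s.sum = α) : ∃ H : Subgroup (ZMod (evenLevel (cyclotomicConductor α)))ˣ,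
      Nat.card H = conductorDegree α ∧
        ∀ k, k ∈ H ↔ (s.map (· ^ k.val.val)).sum = α := by
  obtain ⟨hc, hle⟩ := cyclotomicConductor_spec hα
  have hN := pow_evenLevel_conductor_eq_one hα hs hsα
  have hNpos := evenLevel_pos hc
  rw [conductorDegree]
  rw [← cyclotomicSubfield_evenLevel hc] at hle ⊢
  generalize evenLevel (cyclotomicConductor α) = N at *
  have : NeZero N := ⟨hNpos.ne'⟩
  have h1 := (zeta_isPrimitiveRoot hNpos).adjoin_isCyclotomicExtension ℚ
  have hsub : (cyclotomicSubfield N).toSubalgebra = Algebra.adjoin ℚ {zeta N} :=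
    adjoin_simple_toSubalgebra_of_isAlgebraic (isIntegral_zeta hNpos).isAlgebraic
  have hcyc : @IsCyclotomicExtension {N} ℚ (cyclotomicSubfield N) _ _ (cyclotomicSubfield N).algebra' :=
    IsCyclotomicExtension.equiv {N} ℚ (Algebra.adjoin ℚ {zeta N})
      (Subalgebra.equivOfEq _ _ hsub.symm)
  have hcyc' : IsCyclotomicExtension {N} ℚ (cyclotomicSubfield N) := by
    convert! hcyc
  let ψ : cyclotomicSubfield N →ₐ[ℚ] ℂ := (algebraMap (cyclotomicSubfield N) ℂ).toRatAlgHom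
  have hψ : ψ.fieldRange = cyclotomicSubfield N := by
    ext x; simp [ψ]
  let t : Multiset (cyclotomicSubfield N) := s.attach.map fun y =>
    ⟨y.1, mem_cyclotomicSubfield_of_pow_eq_one hNpos (hN y.1 y.2)⟩
  have htk : ∀ k : ℕ, ψ (t.map (· ^ k)).sum = (s.map (· ^ k)).sum := fun k => by
    rw [map_multiset_sum, Multiset.map_map, Multiset.map_map]
    conv_rhs => rw [← Multiset.attach_map_val s, Multiset.map_map]
    rfl
  have htα : ψ t.sum = α := by simpa [hsα] using htk 1
  obtain ⟨H, hH, hmem⟩ := exists_subgroup_card_eq_relfinrank (N := N) ψ t.sum t (by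
    intro y hy
    obtain ⟨z, -, rfl⟩ := Multiset.mem_map.1 hy
    exact Subtype.ext (hN z.1 z.2)) rfl
  refine ⟨H, ?_, fun k => ?_⟩
  · rw [hH, htα, hψ]
  · rw [hmem, ← htk, ← (show Function.Injective ψ from ψ.injective).eq_iff, htα]
end Conductor

/-! ### Splitting short vanishing sums. -/

theorem card_le_card_of_fiber_sum_ne_zero {ι β : Type*} [DecidableEq β] {s : Multiset ℂ}
    (f : ℂ → β) (C : Finset ι) (g : ι → β) (hg : Set.InjOn g C)
    (h : ∀ i ∈ C, (s.filter fun y => f y = g i).sum ≠ 0) : C.card ≤ s.card := by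
  refine le_trans ?_ (Multiset.card_le_card (s.sum_filter_fiber_le f C g hg))
  rw [Multiset.card_sum, Finset.card_eq_sum_ones]
  refine Finset.sum_le_sum fun i hi => Nat.one_le_iff_ne_zero.2 fun h0 => h i hi ?_
  rw [Multiset.card_eq_zero.1 h0, Multiset.sum_zero]

theorem zero_mem_cyclotomicSubfield_of_eq {n : ℕ} {a : ℂ} (h : a = 0) :
    a ∈ cyclotomicSubfield n := h ▸ zero_mem _

theorem sum_map_inv_mul_filter (t : Multiset ℂ) {z : ℂ} (hz : z ≠ 0) (m : ℕ) (w : ℂ) :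
    ((t.map (z⁻¹ * ·)).filter fun y => y ^ m = w ^ m).sum =
      z⁻¹ * (t.filter fun y => y ^ m = (z * w) ^ m).sum := by
  rw [Multiset.filter_map, Multiset.sum_map_mul_left, Multiset.map_id']
  congr 2
  refine Multiset.filter_congr fun y _ => ?_
  simp only [Function.comp_apply, mul_pow, inv_pow]
  rw [inv_mul_eq_iff_eq_mul₀ (pow_ne_zero _ hz)]

/-- A vanishing sum of roots of unity from one coset of the `p * m`-th roots of unity splits over
the cosets of the `m`-th roots of unity if `p ∣ m` or if it has fewer than `p` terms. -/
theorem sum_filter_pow_eq_zero {p m : ℕ} (hp : p.Prime) (hm : 0 < m) {t : Multiset ℂ}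
    (h0 : ∀ y ∈ t, y ≠ 0) (ht : ∀ y ∈ t, ∀ z ∈ t, y ^ (p * m) = z ^ (p * m)) (hsum : t.sum = 0)
    (hc : p ∣ m ∨ t.card < p) (x : ℂ) : (t.filter fun y => y ^ m = x ^ m).sum = 0 := by
  by_cases hx : ∃ z ∈ t, z ^ m = x ^ m
  swap
  · push Not at hx
    rw [Multiset.filter_eq_nil.2 hx, Multiset.sum_zero]
  obtain ⟨z, hz, hzx⟩ := hx
  rw [← hzx]
  have hz0 := h0 z hz
  have ht' : ∀ y ∈ t.map (z⁻¹ * ·), y ^ (p * m) = 1 := fun y hy => by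
    obtain ⟨w, hw, rfl⟩ := Multiset.mem_map.1 hy
    rw [mul_pow, ht w hw z hz, inv_pow, inv_mul_cancel₀ (pow_ne_zero _ hz0)]
  have hsum' : (t.map (z⁻¹ * ·)).sum = 0 := by
    rw [Multiset.sum_map_mul_left, Multiset.map_id', hsum, mul_zero]
  have key : ((t.map (z⁻¹ * ·)).filter fun y => y ^ m = 1 ^ m).sum = 0 := by
    by_cases hpm : p ∣ m
    · rw [sum_filter_pow_eq_of_dvd hp hm hpm ht' (zero_mem_cyclotomicSubfield_of_eq hsum')
        (one_pow _), hsum', ite_self]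
    · obtain ⟨c, h⟩ := exists_sum_filter_pow_eq hp hm hpm ht'
        (zero_mem_cyclotomicSubfield_of_eq hsum')
      simp only [hsum', ite_self, add_zero] at h
      rw [h 1 (one_pow _), one_mul]
      -- The coset sums are `η * c`; if `c ≠ 0`, all `p` cosets are occupied, which takes at least
      -- `p` terms.
      by_contra hc0
      have := card_le_card_of_fiber_sum_ne_zero (s := t.map (z⁻¹ * ·)) (fun y => y ^ m)
        (Polynomial.nthRootsFinset p (1 : ℂ)) (fun y => y ^ m) (fun a ha b hb hab => ?_) ?_
      · rw [(Complex.isPrimitiveRoot_exp p hp.ne_zero).card_nthRootsFinset,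
          Multiset.card_map] at this
        have := hc.resolve_left hpm
        omega
      · exact eq_of_pow_eq_pow_of_prime hp hpm ((Polynomial.mem_nthRootsFinset hp.pos _).1 ha)
          ((Polynomial.mem_nthRootsFinset hp.pos _).1 hb) hab
      · intro η hη
        have hη := (Polynomial.mem_nthRootsFinset hp.pos _).1 hη
        rw [h η hη]
        refine mul_ne_zero ?_ hc0
        rintro rfl
        simp [hp.ne_zero] at hη
  rw [sum_map_inv_mul_filter t hz0, mul_one] at key
  exact (mul_eq_zero.1 key).resolve_left (inv_ne_zero hz0)

/-- `210` is the product of the primes up to `7`, and the next prime `11` exceeds ten, the bound on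
the number of terms below. -/
theorem prime_dvd_or_lt {p : ℕ} (hp : p.Prime) : p ∣ 210 ∨ 10 < p := by
  by_contra! h
  obtain ⟨h1, h2⟩ := h
  interval_cases p <;> revert hp h1 <;> decide

/-- A vanishing sum of at most ten roots of unity splits over the cosets of the `210`-th roots of
unity. -/
theorem sum_filter_pow_210_eq_zero {t : Multiset ℂ} (ht : ∀ y ∈ t, IsOfFinOrder y)
    (hsum : t.sum = 0) (hc : t.card ≤ 10) (x : ℂ) :
    (t.filter fun y => y ^ 210 = x ^ 210).sum = 0 := by
  suffices H : ∀ d : ℕ, 0 < d → ∀ t : Multiset ℂ, (∀ y ∈ t, IsOfFinOrder y) →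
      t.sum = 0 → t.card ≤ 10 → (∀ y ∈ t, ∀ z ∈ t, y ^ (d * 210) = z ^ (d * 210)) →
      (t.filter fun y => y ^ 210 = x ^ 210).sum = 0 by
    have h1 : ∀ y ∈ t, y ^ ((t.map orderOf).prod * 210) = 1 := fun y hy =>
      orderOf_dvd_iff_pow_eq_one.1
        ((Multiset.dvd_prod (Multiset.mem_map_of_mem orderOf hy)).mul_right 210)
    refine H (t.map orderOf).prod ?_ t ht hsum hc fun y hy z hz => (h1 y hy).trans (h1 z hz).symm
    rw [Nat.pos_iff_ne_zero, Ne, Multiset.prod_eq_zero_iff]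
    rintro h
    obtain ⟨y, hy, h0⟩ := Multiset.mem_map.1 h
    exact (ht y hy).orderOf_pos.ne' h0
  intro d
  induction d using Nat.strong_induction_on with
  | _ d ih =>
    intro hd t ht hsum hc h
    rcases Nat.lt_or_ge 1 d with h1 | h1
    · obtain ⟨p, hp, e, rfl⟩ := Nat.exists_prime_and_dvd h1.ne'
      have he : 0 < e := Nat.pos_of_mul_pos_left hd
      have hS := sum_filter_pow_eq_zero hp (m := e * 210) (by omega)
        (fun y hy => isOfFinOrder_ne_zero (ht y hy)) (by simpa only [mul_assoc] using h) hsum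
        ((prime_dvd_or_lt hp).imp (fun h => h.mul_left _) (fun h => by omega)) x
      have := ih e ((lt_mul_iff_one_lt_left he).2 hp.one_lt) he
        (t.filter fun y => y ^ (e * 210) = x ^ (e * 210))
        (fun y hy => ht y (Multiset.mem_filter.1 hy).1) hS
        ((Multiset.card_le_card (Multiset.filter_le _ _)).trans hc)
        (fun y hy z hz => (Multiset.mem_filter.1 hy).2.trans (Multiset.mem_filter.1 hz).2.symm)
      rw [Multiset.filter_filter] at this
      rw [← this]
      congr 1
      refine Multiset.filter_congr fun y _ => ⟨fun h => ⟨h, ?_⟩, fun h => h.1⟩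
      rw [mul_comm, pow_mul, h, ← pow_mul]
    · obtain rfl : d = 1 := by omega
      rw [one_mul] at h
      by_cases hx : ∃ z ∈ t, z ^ 210 = x ^ 210
      · obtain ⟨z, hz, hzx⟩ := hx
        rw [Multiset.filter_eq_self.2 fun y hy => (h y hy z hz).trans hzx, hsum]
      · push Not at hx
        rw [Multiset.filter_eq_nil.2 hx, Multiset.sum_zero]

/-! ### Groups of power maps acting on roots of unity. -/

section PermutationAction

/-- An element other than `1` and the three double transpositions has a centraliser of order at most
four. If there is no such element, the group lies in the Klein four-group. -/
theorem card_le_four_of_commute (R : Subgroup (Equiv.Perm (Fin 4)))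
    (hR : ∀ a ∈ R, ∀ b ∈ R, a * b = b * a) : Nat.card R ≤ 4 := by
  classical
  have h1 : ∀ a : Equiv.Perm (Fin 4), (a = 1 ∨ (a * a = 1 ∧ ∀ i, a i ≠ i)) ∨
      (Finset.univ.filter fun b => a * b = b * a).card ≤ 4 := by decide +kernel
  have h2 : (Finset.univ.filter fun a : Equiv.Perm (Fin 4) =>
      a = 1 ∨ (a * a = 1 ∧ ∀ i, a i ≠ i)).card ≤ 4 := by decide +kernel
  rw [← SetLike.coe_sort_coe, Nat.card_coe_set_eq]
  by_cases h : ∃ a ∈ R, ¬ (a = 1 ∨ (a * a = 1 ∧ ∀ i, a i ≠ i))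
  · obtain ⟨a, ha, hn⟩ := h
    refine le_trans ?_ ((h1 a).resolve_left hn)
    rw [← Set.ncard_coe_finset]
    exact Set.ncard_le_ncard (fun b hb => by simpa using hR a ha b hb) (Set.toFinite _)
  · push Not at h
    refine le_trans ?_ h2
    rw [← Set.ncard_coe_finset]
    exact Set.ncard_le_ncard (fun b hb => by simpa using h b hb) (Set.toFinite _)

variable {N : ℕ}

theorem pow_val_one {y : ℂ} (hy : y ^ N = 1) : y ^ (1 : ZMod N).val = y := by
  rw [ZMod.val_one_eq_one_mod, pow_eq_pow_of_modEq (Nat.mod_modEq 1 N) hy, pow_one]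

theorem pow_val_mul {y : ℂ} (hy : y ^ N = 1) (a b : ZMod N) :
    y ^ (a * b).val = (y ^ b.val) ^ a.val := by
  rw [ZMod.val_mul, pow_eq_pow_of_modEq (Nat.mod_modEq _ N) hy, ← pow_mul, mul_comm]

/-- A group of power maps which permutes a multiset of at most four roots of unity and acts
faithfully on it has at most four elements. -/
theorem card_le_four_of_map_eq_self (H : Subgroup (ZMod N)ˣ) {s : Multiset ℂ} (hc : s.card ≤ 4)
    (hN : ∀ y ∈ s, y ^ N = 1) (hmap : ∀ k ∈ H, s.map (· ^ k.val.val) = s)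
    (hfaith : ∀ k ∈ H, (∀ y ∈ s, y ^ k.val.val = y) → k = 1) : Nat.card H ≤ 4 := by
  classical
  let A : MulAction H {y // y ∈ s.toFinset} :=
    { smul := fun k y => ⟨y.1 ^ k.1.val.val, by
        rw [Multiset.mem_toFinset]
        have := Multiset.mem_map_of_mem (· ^ k.1.val.val) (Multiset.mem_toFinset.1 y.2)
        rwa [hmap k.1 k.2] at this⟩
      one_smul := fun y => Subtype.ext (pow_val_one (hN y.1 (Multiset.mem_toFinset.1 y.2)))
      mul_smul := fun k l y =>
        Subtype.ext (pow_val_mul (hN y.1 (Multiset.mem_toFinset.1 y.2)) _ _) }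
  have hcard : Fintype.card {y // y ∈ s.toFinset} ≤ Fintype.card (Fin 4) := by
    rw [Fintype.card_coe, Fintype.card_fin]
    exact (Multiset.toFinset_card_le s).trans hc
  obtain ⟨ι⟩ := Function.Embedding.nonempty_of_card_le hcard
  let φ : H →* Equiv.Perm (Fin 4) :=
    (Equiv.Perm.viaEmbeddingHom ι).comp (MulAction.toPermHom H {y // y ∈ s.toFinset})
  have hφ : Function.Injective φ := by
    refine (Equiv.Perm.viaEmbeddingHom_injective ι).comp ?_
    rw [injective_iff_map_eq_one]
    intro k hk
    refine Subtype.ext (hfaith k.1 k.2 fun y hy => ?_)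
    have := congrArg (fun e : Equiv.Perm _ => (e ⟨y, Multiset.mem_toFinset.2 hy⟩).1) hk
    exact this
  rw [Nat.card_congr (MonoidHom.ofInjective hφ).toEquiv]
  refine card_le_four_of_commute _ ?_
  rintro _ ⟨a, rfl⟩ _ ⟨b, rfl⟩
  rw [← map_mul, ← map_mul, mul_comm]

variable [NeZero N]

/-- A group of power maps fixing the sum of a multiset of roots of unity which lies in one coset
of the `M`-th roots of unity, and acting faithfully on it, embeds into `(ZMod M)ˣ`. -/
theorem unitsMap_injective_of_coset {M : ℕ} (hMN : M ∣ N) (H : Subgroup (ZMod N)ˣ)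
    {s : Multiset ℂ} {x : ℂ} (hx : x ≠ 0) (hsx : ∀ y ∈ s, y ^ M = x ^ M) (hs0 : s.sum ≠ 0)
    (hsum : ∀ k ∈ H, (s.map (· ^ k.val.val)).sum = s.sum)
    (hfaith : ∀ k ∈ H, (∀ y ∈ s, y ^ k.val.val = y) → k = 1) :
    Function.Injective ((ZMod.unitsMap hMN).comp H.subtype) := by
  rw [injective_iff_map_eq_one]
  intro k hk
  have hkM : k.1.val.val ≡ 1 [MOD M] := by
    have h1 := congrArg Units.val hk
    simp only [MonoidHom.comp_apply, Subgroup.coe_subtype, ZMod.unitsMap_val, Units.val_one] at h1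
    rw [← ZMod.natCast_eq_natCast_iff, Nat.cast_one, ← h1, ZMod.natCast_val]
  -- For `k` congruent to `1` modulo `M`, the power map multiplies the whole coset by one factor,
  -- which is `1` because it fixes a nonzero sum.
  have hy : ∀ y ∈ s, y ^ k.1.val.val = x ^ k.1.val.val / x * y := fun y hy => by
    have h1 : (y / x) ^ M = 1 := by
      rw [div_pow, hsx y hy, div_self (pow_ne_zero _ hx)]
    have h2 := pow_eq_pow_of_modEq hkM h1
    rw [pow_one, div_pow, div_eq_iff (pow_ne_zero _ hx)] at h2
    rw [h2]; ring
  have h1 := hsum k.1 k.2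
  rw [Multiset.map_congr rfl hy, Multiset.sum_map_mul_left, Multiset.map_id'] at h1
  have h2 := mul_right_cancel₀ hs0 (h1.trans (one_mul _).symm)
  refine Subtype.ext (hfaith k.1 k.2 fun y hys => ?_)
  rw [hy y hys, h2, one_mul]

end PermutationAction

/-! ### Sums of thirtieth roots of unity and the map `w ↦ w ^ 7`. -/

theorem not_isIntegral_of_two_mul_isOfFinOrder {b : ℂ} (hb : IsOfFinOrder (2 * b)) :
    ¬ IsIntegral ℤ b := fun h => by
  have h1 : IsIntegral ℤ (2 * b)⁻¹ := by
    obtain ⟨n, hn, h⟩ := isOfFinOrder_iff_pow_eq_one.1 (isOfFinOrder_inv hb)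
    exact IsIntegral.of_pow hn (h ▸ isIntegral_one)
  have hb0 : b ≠ 0 := by
    rintro rfl
    exact isOfFinOrder_ne_zero hb (mul_zero _)
  -- The product of `b` with the inverse of the root of unity `2 * b` is `1 / 2`.
  have h2 : IsIntegral ℤ (algebraMap ℚ ℂ (1 / 2)) := by
    have e : algebraMap ℚ ℂ (1 / 2) = b * (2 * b)⁻¹ := by
      rw [mul_inv, mul_comm _ b⁻¹, mul_inv_cancel_left₀ hb0]
      simp
    exact e ▸ h.mul h1
  rw [isIntegral_algebraMap_iff (algebraMap ℚ ℂ).injective] at h2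
  obtain ⟨z, hz⟩ := IsIntegrallyClosed.isIntegral_iff.1 h2
  have h3 : (z : ℚ) * 2 = 1 := by
    have : (z : ℚ) = 1 / 2 := hz
    rw [this]; norm_num
  have h4 : z * 2 = 1 := by exact_mod_cast h3
  omega

theorem isIntegral_sum_of_isOfFinOrder {t : Multiset ℂ} (ht : ∀ y ∈ t, IsOfFinOrder y) :
    IsIntegral ℤ t.sum :=
  IsIntegral.multiset_sum fun y hy => by
    obtain ⟨n, hn, h⟩ := isOfFinOrder_iff_pow_eq_one.1 (ht y hy)
    exact IsIntegral.of_pow hn (h ▸ isIntegral_one)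

/-- The elements of `s` in the coset of `ζ ^ i` modulo the sixth roots of unity. -/
noncomputable def fiveClass (s : Multiset ℂ) (ζ : ℂ) (i : ℕ) : Multiset ℂ :=
  s.filter fun w => w ^ 6 = (ζ ^ i) ^ 6

section FiveClass

variable {s : Multiset ℂ} {ζ : ℂ}

theorem injOn_pow_six (hζ : IsPrimitiveRoot ζ 5) :
    Set.InjOn (fun i => (ζ ^ i) ^ 6) (Finset.range 5) := by
  intro i hi j hj hij
  have h1 : ∀ i : ℕ, (ζ ^ i) ^ 5 = 1 := fun i => by
    rw [← pow_mul, mul_comm, pow_mul, hζ.pow_eq_one, one_pow]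
  exact hζ.pow_inj (Finset.mem_range.1 hi) (Finset.mem_range.1 hj)
    (eq_of_pow_eq_pow_of_prime (by norm_num) (by norm_num) (h1 i) (h1 j) hij)

theorem exists_mem_fiveClass (hζ : IsPrimitiveRoot ζ 5) (hs : ∀ w ∈ s, w ^ 30 = 1) {w : ℂ}
    (hw : w ∈ s) : ∃ i ∈ Finset.range 5, w ^ 6 = (ζ ^ i) ^ 6 := by
  obtain ⟨η, hη, h⟩ := exists_pow_eq_pow_of_pow_mul_eq_one (p := 5) (m := 6) (by norm_num)
    (by norm_num) (hs w hw)
  obtain ⟨i, hi, rfl⟩ := hζ.eq_pow_of_pow_eq_one hη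
  exact ⟨i, Finset.mem_range.2 hi, h⟩

theorem sum_fiveClass (hζ : IsPrimitiveRoot ζ 5) (hs : ∀ w ∈ s, w ^ 30 = 1) :
    ∑ i ∈ Finset.range 5, fiveClass s ζ i = s :=
  s.sum_filter_fiber_eq (fun w => w ^ 6) (Finset.range 5) (fun i => (ζ ^ i) ^ 6)
    (injOn_pow_six hζ) fun _ hw => exists_mem_fiveClass hζ hs hw

/-- This is `exists_sum_filter_pow_eq` for the vanishing sum of all `w` and `-v * w ^ 7`. As `7` is
`2` modulo `5` and `1` modulo `6`, the seventh power doubles the class index and does not touch the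
part of order dividing `6`; `3` is the inverse of `2` modulo `5`. -/
theorem exists_fiveClass_relation (hζ : IsPrimitiveRoot ζ 5) (hs : ∀ w ∈ s, w ^ 30 = 1) {v : ℂ}
    (hv : v ^ 6 = 1) (hsum : s.sum = v * (s.map (· ^ 7)).sum) : ∃ c : ℂ, ∀ i : ℕ,
      (fiveClass s ζ i).sum = ζ ^ i * (c + v * ((fiveClass s ζ (3 * i)).sum / ζ ^ (3 * i))) := by
  have hζ0 : ζ ≠ 0 := hζ.ne_zero (by norm_num)
  have ht : ∀ y ∈ s + s.map (fun w => -v * w ^ 7), y ^ (5 * 6) = 1 := fun y hy => by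
    rcases Multiset.mem_add.1 hy with hy | hy
    · exact hs y hy
    · obtain ⟨w, hw, rfl⟩ := Multiset.mem_map.1 hy
      rw [mul_pow, ← pow_mul w, show 7 * (5 * 6) = 30 * 7 by norm_num, pow_mul w, hs w hw,
        neg_pow, pow_mul' v, hv]
      norm_num
  have h0 : (s + s.map (fun w => -v * w ^ 7)).sum = 0 := by
    rw [Multiset.sum_add, Multiset.sum_map_mul_left, hsum]; ring
  obtain ⟨c, hc⟩ := exists_sum_filter_pow_eq (p := 5) (m := 6) (by norm_num) (by norm_num)
    (by norm_num) ht (zero_mem_cyclotomicSubfield_of_eq h0)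
  refine ⟨c, fun i => ?_⟩
  have hi5 : (ζ ^ i) ^ 5 = 1 := by rw [← pow_mul, mul_comm, pow_mul, hζ.pow_eq_one, one_pow]
  have h1 := hc (ζ ^ i) hi5
  rw [h0, ite_self, add_zero, Multiset.filter_add, Multiset.sum_add, Multiset.filter_map] at h1
  have h2 : s.filter ((fun y => y ^ 6 = (ζ ^ i) ^ 6) ∘ fun w => -v * w ^ 7) =
      fiveClass s ζ (3 * i) := by
    refine Multiset.filter_congr fun w hw => ?_
    have hw5 : (w ^ 6) ^ 5 = 1 := by rw [← pow_mul, hs w hw]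
    have e1 : (-v * w ^ 7) ^ 6 = (w ^ 6) ^ 2 := by
      rw [mul_pow, neg_pow, hv, ← pow_mul, ← pow_mul, show 7 * 6 = 30 + 6 * 2 by norm_num, pow_add,
        hs w hw]; norm_num
    have e2 : (ζ ^ i) ^ 6 = (((ζ ^ i) ^ 3) ^ 6) ^ 2 := by
      rw [← pow_mul (ζ ^ i), ← pow_mul (ζ ^ i), show 3 * 6 * 2 = 5 * 6 + 6 by norm_num, pow_add, pow_mul, hi5,
        one_pow, one_mul]
    have e3 : ζ ^ (3 * i) = (ζ ^ i) ^ 3 := by rw [← pow_mul, mul_comm]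
    have e4 : (((ζ ^ i) ^ 3) ^ 6) ^ 5 = 1 := by
      rw [← pow_mul (ζ ^ i), ← pow_mul (ζ ^ i), show 3 * 6 * 5 = 5 * 18 by norm_num, pow_mul, hi5, one_pow]
    simp only [Function.comp_apply]
    rw [e1, e2, e3]
    exact ⟨fun h => eq_of_pow_eq_pow_of_prime (by norm_num) (by norm_num) hw5 e4 h,
      fun h => by rw [h]⟩
  have h3 : ∀ w ∈ fiveClass s ζ (3 * i), -v * w ^ 7 = -v * ζ ^ i / ζ ^ (3 * i) * w := fun w hw => by
    have h4 := (Multiset.mem_filter.1 hw).2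
    rw [pow_succ w 6, h4, ← pow_mul, show 3 * i * 6 = i + i * 17 by ring]
    have h5 : ζ ^ (i + i * 17) = ζ ^ i / ζ ^ (3 * i) := by
      rw [eq_div_iff (pow_ne_zero _ hζ0), ← pow_add,
        show i + i * 17 + 3 * i = 5 * (4 * i) + i by ring, pow_add, pow_mul, hζ.pow_eq_one, one_pow,
        one_mul]
    rw [h5]; ring
  rw [h2, Multiset.map_congr rfl h3, Multiset.sum_map_mul_left, Multiset.map_id'] at h1
  change (fiveClass s ζ i).sum + _ = _ at h1
  linear_combination h1

theorem fiveClass_eq_zero_iff (hs : Reduced s) (i : ℕ) :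
    (fiveClass s ζ i).card = 0 ↔ (fiveClass s ζ i).sum = 0 := by
  rw [Multiset.card_eq_zero]
  exact ⟨fun h => by rw [h, Multiset.sum_zero], fun h => (hs.filter _).eq_zero_of_sum_eq_zero h⟩

/-- A reduced sum of at most four `30`-th roots of unity whose image under `w ↦ w ^ 7` is a multiple
of it by a sixth root of unity consists of sixth roots of unity, or it lies in one coset of the
tenth roots of unity. -/
theorem coset_of_sum_eq_mul_sum_pow_seven (hs : Reduced s) (hs0 : s ≠ 0) (hc : s.card ≤ 4)
    (h30 : ∀ w ∈ s, w ^ 30 = 1) {v : ℂ} (hv : v ^ 6 = 1)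
    (hsum : s.sum = v * (s.map (· ^ 7)).sum) :
    (∀ w ∈ s, w ^ 6 = 1) ∨ ∃ d : ℂ, d ≠ 0 ∧ ∀ w ∈ s, w ^ 10 = d ^ 10 := by
  have hζ : IsPrimitiveRoot (zeta 5) 5 := zeta_isPrimitiveRoot (by norm_num)
  generalize zeta 5 = ζ at hζ
  have hζ0 : ζ ≠ 0 := hζ.ne_zero (by norm_num)
  obtain ⟨c, hrel⟩ := exists_fiveClass_relation hζ h30 hv hsum
  have hS := sum_fiveClass hζ h30
  have hperiod : ∀ i, fiveClass s ζ (5 + i) = fiveClass s ζ i := fun i => by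
    simp only [fiveClass, pow_add, hζ.pow_eq_one, one_mul]
  obtain ⟨B, hB⟩ : ∃ B : ℕ → ℂ, ∀ i, (fiveClass s ζ i).sum = ζ ^ i * B i :=
    ⟨fun i => (fiveClass s ζ i).sum / ζ ^ i, fun i => by field_simp⟩
  have hBrel : ∀ i, B i = c + v * B (3 * i) := fun i => by
    have := hrel i
    rw [hB, hB, mul_div_cancel_left₀ _ (pow_ne_zero _ hζ0)] at this
    exact mul_left_cancel₀ (pow_ne_zero _ hζ0) this
  have hBper : ∀ i, B (5 + i) = B i := fun i => by
    have := hB (5 + i)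
    rw [hperiod, hB, pow_add, hζ.pow_eq_one, one_mul] at this
    exact (mul_left_cancel₀ (pow_ne_zero _ hζ0) this).symm
  have hn : ∀ i, (fiveClass s ζ i).card = 0 ↔ B i = 0 := fun i => by
    rw [fiveClass_eq_zero_iff hs, hB]
    simp [hζ0]
  -- Multiplication by `3` fixes the index `0` and permutes the others in the cycle `1, 3, 4, 2`.
  have r0 : B 0 = c + v * B 0 := hBrel 0
  have r1 : B 1 = c + v * B 3 := hBrel 1
  have r2 : B 2 = c + v * B 1 := (hBrel 2).trans (by rw [← hBper 1])
  have r3 : B 3 = c + v * B 4 := (hBrel 3).trans (by rw [← hBper 4])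
  have r4 : B 4 = c + v * B 2 := (hBrel 4).trans (by rw [← hBper 2, ← hBper (5 + 2)])
  have hcard : (fiveClass s ζ 0).card + (fiveClass s ζ 1).card + (fiveClass s ζ 2).card +
      (fiveClass s ζ 3).card + (fiveClass s ζ 4).card = s.card := by
    conv_rhs => rw [← hS]
    simp [Finset.sum_range_succ]
  have hpos : 0 < s.card := Multiset.card_pos.2 hs0
  have hcl := fun i => (hs.filter fun w => w ^ 6 = (ζ ^ i) ^ 6)
  have hn0 := hn 0
  have hn1 := hn 1
  have hn2 := hn 2
  have hn3 := hn 3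
  have hn4 := hn 4
  -- Five classes cannot all be occupied by at most four elements.
  have hall : ¬ (B 0 ≠ 0 ∧ B 1 ≠ 0 ∧ B 2 ≠ 0 ∧ B 3 ≠ 0 ∧ B 4 ≠ 0) := fun ⟨h0, h1, h2, h3, h4⟩ => by
    replace h0 := hn0.not.2 h0
    replace h1 := hn1.not.2 h1
    replace h2 := hn2.not.2 h2
    replace h3 := hn3.not.2 h3
    replace h4 := hn4.not.2 h4
    omega
  have hsingle : ∀ i, (fiveClass s ζ i).card = 1 → IsOfFinOrder (B i) := fun i hi => by
    obtain ⟨a, ha⟩ := Multiset.card_eq_one.1 hi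
    have h1 := hB i
    rw [ha, Multiset.sum_singleton] at h1
    have ha' : IsOfFinOrder a := (hcl i).1 a (by
      change a ∈ fiveClass s ζ i
      rw [ha]; simp)
    have h2 : B i = (ζ ^ i)⁻¹ * a := by rw [h1]; field_simp
    rw [h2]
    exact isOfFinOrder_mul (isOfFinOrder_inv ((isOfFinOrder_of_pow_eq_one (by norm_num)
      hζ.pow_eq_one).pow)) ha'
  have hint : IsIntegral ℤ (B 0) := by
    have h1 := hB 0
    rw [pow_zero, one_mul] at h1
    rw [← h1]
    exact isIntegral_sum_of_isOfFinOrder (hcl 0).1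
  by_cases hv1 : v = 1
  · subst hv1
    have e3 : c = 0 := by linear_combination -r0
    subst e3
    by_cases hb : B 1 = 0
    · left
      intro w hw
      obtain ⟨i, hi, hwi⟩ := exists_mem_fiveClass hζ h30 hw
      by_cases hi0 : i = 0
      · rw [hwi, hi0]; simp
      · exfalso
        have hBi : B i = 0 := by
          rw [Finset.mem_range] at hi
          interval_cases i
          · exact absurd rfl hi0
          · exact hb
          · linear_combination r2 + hb
          · linear_combination -r1 + hb
          · linear_combination r4 + r2 + hb
        have := (hn i).2 hBi
        rw [Multiset.card_eq_zero] at this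
        exact Multiset.filter_eq_nil.1 this w hw hwi
    · exfalso
      have h2 : B 2 ≠ 0 := fun h => hb (by linear_combination h - r2)
      have h3 : B 3 ≠ 0 := fun h => hb (by linear_combination h + r1)
      have h4 : B 4 ≠ 0 := fun h => hb (by linear_combination h - r2 - r4)
      have h0 : B 0 = 0 := by
        by_contra h0
        exact hall ⟨h0, hb, h2, h3, h4⟩
      -- Here `B 1 = B 2 = B 3 = B 4`, so the sum is `B 1 * (ζ + ζ ^ 2 + ζ ^ 3 + ζ ^ 4)`, and one
      -- class alone represents it with fewer terms.
      have hsum' : s.sum = -B 1 := by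
        conv_lhs => rw [← hS]
        have hg := hζ.geom_sum_eq_zero (by norm_num)
        simp only [Finset.sum_range_succ, Finset.sum_range_zero, Multiset.sum_add, hB,
          zero_add] at hg ⊢
        linear_combination h0 + ζ ^ 2 * r2 - ζ ^ 3 * r1 + ζ ^ 4 * (r4 + r2) + B 1 * hg
      have hle := hs.card_le ((fiveClass s ζ 1).map (-ζ⁻¹ * ·)) (fun y hy => by
        obtain ⟨w, hw, rfl⟩ := Multiset.mem_map.1 hy
        exact isOfFinOrder_mul (isOfFinOrder_neg (isOfFinOrder_inv (isOfFinOrder_of_pow_eq_one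
          (by norm_num) hζ.pow_eq_one))) ((hcl 1).1 w hw)) (by
        rw [Multiset.sum_map_mul_left, Multiset.map_id', hB, hsum']
        field_simp)
      rw [Multiset.card_map] at hle
      replace h2 := hn2.not.2 h2
      omega
  · have q1 : B 1 - B 0 = v * (B 3 - B 0) := by linear_combination r1 - r0
    have q2 : B 2 - B 0 = v * (B 1 - B 0) := by linear_combination r2 - r0
    have q3 : B 3 - B 0 = v * (B 4 - B 0) := by linear_combination r3 - r0
    have q4 : B 4 - B 0 = v * (B 2 - B 0) := by linear_combination r4 - r0
    by_cases hd : B 1 - B 0 = 0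
    · exfalso
      have d2 : B 2 = B 0 := by linear_combination q2 + v * hd
      have d4 : B 4 = B 0 := by linear_combination q4 + v * d2
      have d3 : B 3 = B 0 := by linear_combination q3 + v * d4
      have d1 : B 1 = B 0 := by linear_combination hd
      by_cases h0 : B 0 = 0
      · rw [d1] at hn1
        rw [d2] at hn2
        rw [d3] at hn3
        rw [d4] at hn4
        have := hn0.2 h0
        have := hn1.2 h0
        have := hn2.2 h0
        have := hn3.2 h0
        have := hn4.2 h0
        omega
      · exact hall ⟨h0, d1 ▸ h0, d2 ▸ h0, d3 ▸ h0, d4 ▸ h0⟩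
    · have hv4 : v ^ 4 = 1 := by
        apply mul_right_cancel₀ hd
        linear_combination -q1 - v * q3 - v ^ 2 * q4 - v ^ 3 * q2
      have hv2 : v ^ 2 = 1 := by linear_combination hv - v ^ 2 * hv4
      have hvm : v = -1 := by
        have h1 : (v - 1) * (v + 1) = 0 := by linear_combination hv2
        rcases mul_eq_zero.1 h1 with h | h
        · exact absurd (sub_eq_zero.1 h) hv1
        · exact eq_neg_of_add_eq_zero_left h
      subst hvm
      have d2 : B 2 = 2 * B 0 - B 1 := by linear_combination q2
      have d4 : B 4 = B 1 := by linear_combination q4 - q2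
      have d3 : B 3 = 2 * B 0 - B 1 := by linear_combination q3 - q4 + q2
      by_cases h0 : B 0 = 0
      · right
        have hb : B 1 ≠ 0 := fun h => hd (by rw [h, h0, sub_zero])
        refine ⟨B 1, hb, fun w hw => ?_⟩
        have h2 : B 2 ≠ 0 := fun h => hb (by linear_combination d2 - h + 2 * h0)
        have h3 : B 3 ≠ 0 := fun h => hb (by linear_combination d3 - h + 2 * h0)
        have h4 : B 4 ≠ 0 := fun h => hb (by linear_combination h - d4)
        have h1 := hb
        replace h1 := hn1.not.2 h1
        replace h2 := hn2.not.2 h2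
        replace h3 := hn3.not.2 h3
        replace h4 := hn4.not.2 h4
        obtain ⟨i, hi, hwi⟩ := exists_mem_fiveClass hζ h30 hw
        have hmem : w ∈ fiveClass s ζ i := Multiset.mem_filter.2 ⟨hw, hwi⟩
        rw [Finset.mem_range] at hi
        have hi1 : (fiveClass s ζ i).card = 1 := by
          have h5 := hn0.2 h0
          interval_cases i
          · rw [Multiset.card_eq_zero.1 h5] at hmem
            simp at hmem
          all_goals omega
        have hBi : B i ^ 10 = B 1 ^ 10 := by
          interval_cases i
          · have h5 := hn0.2 h0
            omega
          · rfl
          · rw [d2, h0]; ring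
          · rw [d3, h0]; ring
          · rw [d4]
        obtain ⟨a, ha⟩ := Multiset.card_eq_one.1 hi1
        have hsi := hB i
        rw [ha] at hmem hsi
        rw [Multiset.mem_singleton.1 hmem, ← hBi, ← Multiset.sum_singleton a, hsi, mul_pow, ← pow_mul,
          mul_comm i, show 10 * i = 5 * (2 * i) by ring, pow_mul, hζ.pow_eq_one, one_pow, one_mul]
      · exfalso
        have hc0 : (fiveClass s ζ 0).card ≠ 0 := hn0.not.2 h0
        -- Some class is empty, so either `B 1 = B 4 = 0` or `B 2 = B 3 = 0`, and the other two
        -- values are `2 * B 0`. Class `0` is occupied, so one of those two classes is a singleton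
        -- and `2 * B 0` is a root of unity, although `B 0` is integral.
        have h20 : 2 * B 0 ≠ 0 := mul_ne_zero two_ne_zero h0
        by_cases hb : B 1 = 0
        · have h2 : B 2 = 2 * B 0 := by linear_combination d2 - hb
          have h3 : B 3 = 2 * B 0 := by linear_combination d3 - hb
          have c2 : (fiveClass s ζ 2).card ≠ 0 := hn2.not.2 (h2 ▸ h20)
          have c3 : (fiveClass s ζ 3).card ≠ 0 := hn3.not.2 (h3 ▸ h20)
          rcases (by omega : (fiveClass s ζ 2).card = 1 ∨ (fiveClass s ζ 3).card = 1) with h | h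
          · exact not_isIntegral_of_two_mul_isOfFinOrder (h2 ▸ hsingle 2 h) hint
          · exact not_isIntegral_of_two_mul_isOfFinOrder (h3 ▸ hsingle 3 h) hint
        · have h2 : B 2 = 0 := by
            by_contra h2
            exact hall ⟨h0, hb, h2, by rwa [d3, ← d2], by rwa [d4]⟩
          have h1 : B 1 = 2 * B 0 := by linear_combination d2 - h2
          have h4 : B 4 = 2 * B 0 := d4.trans h1
          have c1 : (fiveClass s ζ 1).card ≠ 0 := hn1.not.2 hb
          have c4 : (fiveClass s ζ 4).card ≠ 0 := hn4.not.2 (h4 ▸ h20)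
          rcases (by omega : (fiveClass s ζ 1).card = 1 ∨ (fiveClass s ζ 4).card = 1) with h | h
          · exact not_isIntegral_of_two_mul_isOfFinOrder (h1 ▸ hsingle 1 h) hint
          · exact not_isIntegral_of_two_mul_isOfFinOrder (h4 ▸ hsingle 4 h) hint

end FiveClass

/-! ### The stabiliser when all relations split over the thirtieth roots of unity. -/

section CosetOfThirty

variable {N : ℕ} [NeZero N] {H : Subgroup (ZMod N)ˣ} {s : Multiset ℂ}

theorem card_le_totient_of_coset {M : ℕ} (hMN : M ∣ N) {x : ℂ} (hx : x ≠ 0)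
    (hsx : ∀ y ∈ s, y ^ M = x ^ M) (hs0 : s.sum ≠ 0)
    (hsum : ∀ k ∈ H, (s.map (· ^ k.val.val)).sum = s.sum)
    (hfaith : ∀ k ∈ H, (∀ y ∈ s, y ^ k.val.val = y) → k = 1) : Nat.card H ≤ Nat.totient M := by
  have : NeZero M := ⟨fun h => NeZero.ne N (Nat.eq_zero_of_zero_dvd (h ▸ hMN))⟩
  have h := Nat.card_le_card_of_injective _
    (unitsMap_injective_of_coset hMN H hx hsx hs0 hsum hfaith)
  rwa [Nat.card_eq_fintype_card (α := (ZMod M)ˣ), ZMod.card_units_eq_totient] at h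

/-- If `30 ∤ N`, the coset is one modulo a proper even divisor of `30`, whose totient is at most
`4`. Otherwise a group with more than four elements fills `(ZMod 30)ˣ`, and an element congruent to
`7` confines `s` to a coset of the sixth or tenth roots of unity, where the totients are `2` and
`4`. -/
theorem card_le_four_of_thirty_coset (h2 : 2 ∣ N) (hs : Reduced s) (hc : s.card ≤ 4)
    (hN : ∀ y ∈ s, y ^ N = 1) {x : ℂ} (hxs : x ∈ s) (hx : ∀ y ∈ s, y ^ 30 = x ^ 30)
    (hsum : ∀ k ∈ H, (s.map (· ^ k.val.val)).sum = s.sum)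
    (hcos : ∀ k ∈ H, (x ^ k.val.val) ^ 30 = x ^ 30)
    (hfaith : ∀ k ∈ H, (∀ y ∈ s, y ^ k.val.val = y) → k = 1) : Nat.card H ≤ 4 := by
  have hxf := hs.1 x hxs
  have hx0 := isOfFinOrder_ne_zero hxf
  have hs0 : s ≠ 0 := by rintro rfl; simp at hxs
  have hsum0 : s.sum ≠ 0 := fun h => hs0 (hs.eq_zero_of_sum_eq_zero h)
  by_cases h30 : 30 ∣ N
  swap
  · have hsx : ∀ y ∈ s, y ^ Nat.gcd 30 N = x ^ Nat.gcd 30 N := fun y hy => by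
      have h1 : (y / x) ^ Nat.gcd 30 N = 1 := pow_gcd_eq_one.2
        ⟨by rw [div_pow, hx y hy, div_self (pow_ne_zero _ hx0)],
          by rw [div_pow, hN y hy, hN x hxs, div_one]⟩
      rwa [div_pow, div_eq_one_iff_eq (pow_ne_zero _ hx0)] at h1
    refine (card_le_totient_of_coset (Nat.gcd_dvd_right 30 N) hx0 hsx hsum0 hsum hfaith).trans ?_
    have h1 : Nat.gcd 30 N ∈ Nat.divisors 30 := by simp [Nat.gcd_dvd_left]
    have h3 : 2 ∣ Nat.gcd 30 N := Nat.dvd_gcd (by norm_num) h2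
    have h4 : Nat.gcd 30 N ≠ 30 := fun h => h30 (h ▸ Nat.gcd_dvd_right 30 N)
    have key : ∀ M ∈ Nat.divisors 30, 2 ∣ M → M ≠ 30 → Nat.totient M ≤ 4 := by decide
    exact key _ h1 h3 h4
  by_contra! hlt
  obtain ⟨j, hj, hj7⟩ : ∃ j ∈ H, j.val.val ≡ 7 [MOD 30] := by
    have hinj := unitsMap_injective_of_coset h30 H hx0 hx hsum0 hsum hfaith
    have hcard := Nat.card_congr (MonoidHom.ofInjective hinj).toEquiv
    have h8 : Nat.card (ZMod 30)ˣ = 8 := by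
      rw [Nat.card_eq_fintype_card, ZMod.card_units_eq_totient]; decide
    have hdvd := Subgroup.card_subgroup_dvd_card ((ZMod.unitsMap h30).comp H.subtype).range
    rw [← hcard, h8] at hdvd
    have h8' : Nat.card H = 8 := by
      obtain ⟨q, hq⟩ := hdvd
      have : q < 2 := by
        by_contra hq2
        have : Nat.card H * 2 ≤ Nat.card H * q := Nat.mul_le_mul_left _ (by omega)
        omega
      interval_cases q <;> omega
    have htop : ((ZMod.unitsMap h30).comp H.subtype).range = ⊤ :=
      Subgroup.eq_top_of_card_eq _ (by rw [← hcard, h8', h8])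
    have hmem : ZMod.unitOfCoprime 7 (by norm_num : Nat.Coprime 7 30) ∈
        ((ZMod.unitsMap h30).comp H.subtype).range := htop ▸ Subgroup.mem_top _
    obtain ⟨j, hj⟩ := hmem
    refine ⟨j.1, j.2, ?_⟩
    have h1 := congrArg Units.val hj
    simp only [MonoidHom.comp_apply, Subgroup.coe_subtype, ZMod.unitsMap_val,
      ZMod.coe_unitOfCoprime] at h1
    rw [← ZMod.natCast_eq_natCast_iff, ← h1, ZMod.natCast_val]
  have hcosj := hcos j hj
  have hsumj := hsum j hj
  generalize j.val.val = n at hj7 hcosj hsumj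
  have hu : (x ^ n / x) ^ (5 * 6) = 1 := by
    rw [div_pow, hcosj, div_self (pow_ne_zero _ hx0)]
  -- Dividing `x` by the fifth-root part `η` of `x ^ n / x` gives `X` with `X ^ n = X * v` and `v ^
  -- 6 = 1`, since `η⁻¹ ^ 7 = η⁻¹ ^ 2`.
  obtain ⟨η, hη, huη⟩ := exists_pow_eq_pow_of_pow_mul_eq_one (p := 5) (m := 6) (by norm_num)
    (by norm_num) hu
  have hη0 : η ≠ 0 := by rintro rfl; norm_num at hη
  have hθ : (η⁻¹) ^ 5 = 1 := by rw [inv_pow, hη, inv_one]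
  have hθ30 : (η⁻¹) ^ 30 = 1 := by
    rw [show 30 = 5 * 6 by norm_num, pow_mul, hθ, one_pow]
  have hX0 : x * η⁻¹ ≠ 0 := mul_ne_zero hx0 (inv_ne_zero hη0)
  have hv : (x ^ n / x * η⁻¹) ^ 6 = 1 := by
    rw [mul_pow, huη, ← mul_pow, mul_inv_cancel₀ hη0, one_pow]
  have hXn : (x * η⁻¹) ^ n = x * η⁻¹ * (x ^ n / x * η⁻¹) := by
    rw [mul_pow, pow_eq_pow_of_modEq hj7 hθ30, show 7 = 5 + 2 by norm_num, pow_add, hθ]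
    field_simp
  have hX30 : (x * η⁻¹) ^ 30 = x ^ 30 := by rw [mul_pow, hθ30, mul_one]
  have hXf : IsOfFinOrder (x * η⁻¹) :=
    isOfFinOrder_mul hxf (isOfFinOrder_of_pow_eq_one (by norm_num) hθ)
  generalize x ^ n / x * η⁻¹ = v at *
  generalize x * η⁻¹ = X at *
  have hw30 : ∀ w ∈ s.map (X⁻¹ * ·), w ^ 30 = 1 := fun w hw => by
    obtain ⟨y, hy, rfl⟩ := Multiset.mem_map.1 hw
    rw [mul_pow, hx y hy, inv_pow, hX30, inv_mul_cancel₀ (pow_ne_zero _ hx0)]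
  have hrel : (s.map (X⁻¹ * ·)).sum = v * ((s.map (X⁻¹ * ·)).map (· ^ 7)).sum := by
    rw [Multiset.sum_map_mul_left, Multiset.map_id', ← hsumj, ← Multiset.sum_map_mul_left,
      ← Multiset.sum_map_mul_left, Multiset.map_map]
    refine congrArg _ (Multiset.map_congr rfl fun y hy => ?_)
    have h1 : (X⁻¹ * y) ^ n = (X⁻¹ * y) ^ 7 :=
      pow_eq_pow_of_modEq hj7 (hw30 _ (Multiset.mem_map_of_mem _ hy))
    simp only [Function.comp_apply]
    rw [← h1, mul_pow, inv_pow, hXn]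
    have hv0 : v ≠ 0 := by rintro rfl; norm_num at hv
    field_simp
  have hback : ∀ (d : ℂ) (m : ℕ), (∀ w ∈ s.map (X⁻¹ * ·), w ^ m = d ^ m) →
      ∀ y ∈ s, y ^ m = (X * d) ^ m := fun d m h y hy => by
    rw [mul_pow, ← h _ (Multiset.mem_map_of_mem _ hy), ← mul_pow, mul_inv_cancel_left₀ hX0]
  rcases coset_of_sum_eq_mul_sum_pow_seven (hs.map_mul (isOfFinOrder_inv hXf)) (by simpa using hs0)
    (by simpa using hc) hw30 hv hrel with h | ⟨d, hd, h⟩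
  · have h1 := card_le_totient_of_coset ((by norm_num : 6 ∣ 30).trans h30)
      (mul_ne_zero hX0 one_ne_zero) (hback 1 6 (by simpa using h)) hsum0 hsum hfaith
    have h6 : Nat.totient 6 = 2 := by decide
    omega
  · have h1 := card_le_totient_of_coset ((by norm_num : 10 ∣ 30).trans h30)
      (mul_ne_zero hX0 hd) (hback d 10 h) hsum0 hsum hfaith
    have h10 : Nat.totient 10 = 4 := by decide
    omega

/-- Two reduced multisets with the same sums over the cosets of the `30`-th roots of unity agree
if every coset contains at most two elements. -/
theorem eq_of_forall_sum_filter_eq {t : Multiset ℂ} (hs : Reduced s) (ht : Reduced t)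
    (hst : ∀ x : ℂ, (s.filter fun y => y ^ 30 = x ^ 30).sum =
      (t.filter fun y => y ^ 30 = x ^ 30).sum)
    (h2 : ∀ z ∈ s, (s.filter fun y => y ^ 30 = z ^ 30).card ≤ 2) : s = t := by
  classical
  have key : ∀ x : ℂ, (s.filter fun y => y ^ 30 = x ^ 30) = t.filter fun y => y ^ 30 = x ^ 30 := by
    intro x
    refine (hs.filter _).unique_of_card_le_two (ht.filter _) (hst x) ?_
    by_cases hx : ∃ z ∈ s, z ^ 30 = x ^ 30
    · obtain ⟨z, hz, hzx⟩ := hx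
      rw [← hzx]
      exact h2 z hz
    · push Not at hx
      rw [Multiset.filter_eq_nil.2 hx]; simp
  ext a
  have h1 : ∀ u : Multiset ℂ, u.count a = (u.filter fun y => y ^ 30 = a ^ 30).count a := fun u => by
    rw [Multiset.count_filter, if_pos rfl]
  rw [h1 s, h1 t, key]

/-- If all the relations `∑ y = ∑ y ^ k` split over the cosets of the `30`-th roots of unity, the
stabiliser has at most four elements. -/
theorem card_le_four_of_splitting (h2 : 2 ∣ N) (hs : Reduced s) (hc : s.card ≤ 4)
    (hN : ∀ y ∈ s, y ^ N = 1) (hsum : ∀ k ∈ H, (s.map (· ^ k.val.val)).sum = s.sum)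
    (hred : ∀ k ∈ H, Reduced (s.map (· ^ k.val.val)))
    (hsplit : ∀ k ∈ H, ∀ x : ℂ, (s.filter fun y => y ^ 30 = x ^ 30).sum =
      ((s.map (· ^ k.val.val)).filter fun y => y ^ 30 = x ^ 30).sum)
    (hfaith : ∀ k ∈ H, (∀ y ∈ s, y ^ k.val.val = y) → k = 1) : Nat.card H ≤ 4 := by
  by_cases h : ∀ z ∈ s, (s.filter fun y => y ^ 30 = z ^ 30).card ≤ 2
  · exact card_le_four_of_map_eq_self H hc hN
      (fun k hk => (eq_of_forall_sum_filter_eq hs (hred k hk) (hsplit k hk) h).symm) hfaith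
  push Not at h
  obtain ⟨z, hz, hz3⟩ := h
  have hadd := Multiset.filter_add_not (fun y => y ^ 30 = z ^ 30) s
  have hcard := congrArg Multiset.card hadd
  rw [Multiset.card_add] at hcard
  have hpow : ∀ (k : ℕ) (y : ℂ), y ^ 30 = z ^ 30 → (y ^ k) ^ 30 = (z ^ k) ^ 30 := fun k y hy => by
    rw [← pow_mul, mul_comm, pow_mul, hy, ← pow_mul, mul_comm, pow_mul]
  have hk : ∀ k ∈ H, (z ^ k.val.val) ^ 30 = z ^ 30 ∧
      ((s.filter fun y => y ^ 30 = z ^ 30).map (· ^ k.val.val)).sum =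
        (s.filter fun y => y ^ 30 = z ^ 30).sum := by
    intro k hk
    have e1 := hsplit k hk z
    have e2 := (hs.filter _).card_eq ((hred k hk).filter _) e1
    rw [Multiset.filter_map, Multiset.card_map] at e2
    rw [Multiset.filter_map] at e1
    -- If `k` moved this coset, only elements outside it could land in it; there is at most one of
    -- those, but at least three are needed.
    have e3 : (z ^ k.val.val) ^ 30 = z ^ 30 := by
      by_contra hne
      have : s.filter ((fun y => y ^ 30 = z ^ 30) ∘ fun y => y ^ k.val.val) ≤
          s.filter fun y => ¬ y ^ 30 = z ^ 30 :=
        Multiset.monotone_filter_right s fun y hy hy' => hne ((hpow _ y hy').symm.trans hy)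
      have := Multiset.card_le_card this
      omega
    have e4 : (s.filter fun y => y ^ 30 = z ^ 30) =
        s.filter ((fun y => y ^ 30 = z ^ 30) ∘ fun y => y ^ k.val.val) :=
      Multiset.eq_of_le_of_card_le
        (Multiset.monotone_filter_right s fun y hy => (hpow _ y hy).trans e3) e2.ge
    exact ⟨e3, by rw [e1, ← e4]⟩
  refine card_le_four_of_thirty_coset (x := z) h2 (hs.filter fun y => y ^ 30 = z ^ 30)
    ((Multiset.card_le_card (Multiset.filter_le _ _)).trans hc)
    (fun y hy => hN y (Multiset.mem_filter.1 hy).1) (Multiset.mem_filter.2 ⟨hz, rfl⟩)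
    (fun y hy => (Multiset.mem_filter.1 hy).2) (fun k hk' => (hk k hk').2)
    (fun k hk' => (hk k hk').1) fun k hk' hfix => hfaith k hk' fun y hy => ?_
  by_cases hyz : y ^ 30 = z ^ 30
  · exact hfix y (Multiset.mem_filter.2 ⟨hy, hyz⟩)
  · have hmem : y ∈ s.filter fun y => ¬ y ^ 30 = z ^ 30 := Multiset.mem_filter.2 ⟨hy, hyz⟩
    -- A single element lies outside the coset; it is fixed because both the total and the coset sum
    -- are.
    have h1 : (s.filter fun y => ¬ y ^ 30 = z ^ 30).card = 1 := by
      have := Multiset.card_pos_iff_exists_mem.2 ⟨y, hmem⟩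
      omega
    obtain ⟨a, ha⟩ := Multiset.card_eq_one.1 h1
    rw [ha] at hadd hmem
    have hsk := hsum k hk'
    rw [← hadd, Multiset.map_add, Multiset.sum_add, Multiset.sum_add, (hk k hk').2] at hsk
    rw [Multiset.mem_singleton.1 hmem]
    simpa using hsk

end CosetOfThirty

/-! ### The exceptional relation from seventh roots of unity. -/

/-- The multiset of roots of unity `-X * ω` and `X * ξ` for `ξ ∈ A`. -/
noncomputable def septicForm (X ω : ℂ) (A : Finset ℂ) : Multiset ℂ :=
  (-X * ω) ::ₘ A.val.map (X * ·)

theorem mem_primitiveRoots_seven {ξ : ℂ} :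
    ξ ∈ primitiveRoots 7 ℂ ↔ ξ ^ 7 = 1 ∧ ξ ≠ 1 := by
  rw [mem_primitiveRoots (by norm_num)]
  constructor
  · exact fun h => ⟨h.pow_eq_one, h.ne_one (by norm_num)⟩
  · rintro ⟨h, h1⟩
    have : Fact (Nat.Prime 7) := ⟨by norm_num⟩
    exact IsPrimitiveRoot.iff_orderOf.2 (orderOf_eq_prime h h1)

theorem nthRootsFinset_seven :
    Polynomial.nthRootsFinset 7 (1 : ℂ) = insert 1 (primitiveRoots 7 ℂ) := by
  ext ξ
  rw [Polynomial.mem_nthRootsFinset (by norm_num), Finset.mem_insert, mem_primitiveRoots_seven]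
  by_cases h : ξ = 1
  · simp [h]
  · simp [h]

theorem card_primitiveRoots_seven : (primitiveRoots 7 ℂ).card = 6 := by
  rw [Complex.card_primitiveRoots]; decide

theorem sum_septicForm (X ω : ℂ) (A : Finset ℂ) :
    (septicForm X ω A).sum = X * (-ω + ∑ ξ ∈ A, ξ) := by
  rw [septicForm, Multiset.sum_cons, Multiset.sum_map_mul_left, Multiset.map_id', Finset.sum_val]
  change -X * ω + X * ∑ ξ ∈ A, ξ = _
  ring

theorem card_septicForm (X ω : ℂ) (A : Finset ℂ) : (septicForm X ω A).card = A.card + 1 := by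
  simp [septicForm]

/-- `-X * ω` and `-X * ω ^ 2` add up to `X`, so a reduced `s` contains at most one of them and the
other falls to `t`. The set `A` records which of the six `X * ξ` belong to `s`. -/
theorem exists_septicForm_of_add_eq {s t : Multiset ℂ} {X ω : ℂ} (hX : X ≠ 0)
    (hc : s.card = 4)
    (hst : s + t = (-X * ω) ::ₘ (-X * ω ^ 2) ::ₘ (primitiveRoots 7 ℂ).val.map (X * ·))
    (hsn : ¬ {-X * ω, -X * ω ^ 2} ≤ s) (hmem : -X * ω ∈ s) :
    ∃ A ⊆ primitiveRoots 7 ℂ, A.card = 3 ∧ s = septicForm X ω A ∧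
      t.map (-·) = septicForm (-X) (ω ^ 2) (primitiveRoots 7 ℂ \ A) := by
  classical
  obtain ⟨s₁, rfl⟩ := Multiset.exists_cons_of_mem hmem
  rw [Multiset.cons_add, Multiset.cons_inj_right] at hst
  have hb : -X * ω ^ 2 ∈ s₁ + t := by rw [hst]; exact Multiset.mem_cons_self _ _
  have hbt : -X * ω ^ 2 ∈ t := by
    refine (Multiset.mem_add.1 hb).resolve_left fun h => hsn ?_
    obtain ⟨s₂, rfl⟩ := Multiset.exists_cons_of_mem h
    exact Multiset.cons_le_cons _ (Multiset.cons_le_cons _ (Multiset.zero_le _))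
  obtain ⟨t₁, rfl⟩ := Multiset.exists_cons_of_mem hbt
  rw [Multiset.add_cons, Multiset.cons_inj_right] at hst
  have hnodup : ((primitiveRoots 7 ℂ).val.map (X * ·)).Nodup :=
    (primitiveRoots 7 ℂ).nodup.map (mul_right_injective₀ hX)
  have hs₁ : s₁ = ((primitiveRoots 7 ℂ).filter fun ξ => X * ξ ∈ s₁).val.map (X * ·) := by
    have hle : s₁ ≤ (primitiveRoots 7 ℂ).val.map (X * ·) := hst ▸ Multiset.le_add_right _ _
    refine (Multiset.Nodup.ext (Multiset.nodup_of_le hle hnodup)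
      ((Finset.nodup _).map (mul_right_injective₀ hX))).2 fun y => ?_
    rw [Multiset.mem_map]
    constructor
    · intro hy
      obtain ⟨ξ, hξ, rfl⟩ := Multiset.mem_map.1 (Multiset.mem_of_le hle hy)
      exact ⟨ξ, Finset.mem_filter.2 ⟨hξ, hy⟩, rfl⟩
    · rintro ⟨ξ, hξ, rfl⟩
      exact (Finset.mem_filter.1 hξ).2
  have hA : ((primitiveRoots 7 ℂ).filter fun ξ => X * ξ ∈ s₁) ⊆ primitiveRoots 7 ℂ :=
    Finset.filter_subset _ _
  generalize ((primitiveRoots 7 ℂ).filter fun ξ => X * ξ ∈ s₁) = A at hs₁ hA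
  subst hs₁
  refine ⟨A, hA, by simpa using hc, rfl, ?_⟩
  have hval : (primitiveRoots 7 ℂ).val = A.val + (primitiveRoots 7 ℂ \ A).val := by
    rw [Finset.sdiff_val, add_tsub_cancel_of_le (Finset.val_le_iff.2 hA)]
  rw [hval, Multiset.map_add] at hst
  rw [add_left_cancel hst, septicForm, Multiset.map_cons, Multiset.map_map]
  congr 1
  · ring
  · exact Multiset.map_congr rfl fun ξ _ => by simp

theorem sum_singleton_eq_map (S : Finset ℂ) (f : ℂ → ℂ) :
    ∑ ξ ∈ S, ({f ξ} : Multiset ℂ) = S.val.map f := by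
  rw [Finset.sum, ← Multiset.sum_map_singleton (S.val.map f), Multiset.map_map]
  rfl

/-- A vanishing sum of eight roots of unity in one coset of the `210`-th roots of unity which does
not split over the cosets of the `30`-th roots of unity. -/
theorem exists_eq_cons_cons_map {r : Multiset ℂ} (hr : ∀ y ∈ r, IsOfFinOrder y)
    (hc : r.card = 8) (h0 : r.sum = 0) {z : ℂ} (hz : z ≠ 0) (h210 : ∀ y ∈ r, y ^ 210 = z ^ 210)
    (hz30 : (r.filter fun y => y ^ 30 = z ^ 30).sum ≠ 0) :
    ∃ X ω : ℂ, IsOfFinOrder X ∧ IsPrimitiveRoot ω 3 ∧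
      r = (-X * ω) ::ₘ (-X * ω ^ 2) ::ₘ (primitiveRoots 7 ℂ).val.map (X * ·) := by
  have ht : ∀ y ∈ r.map (z⁻¹ * ·), y ^ (7 * 30) = 1 := fun y hy => by
    obtain ⟨w, hw, rfl⟩ := Multiset.mem_map.1 hy
    rw [mul_pow, h210 w hw, inv_pow, inv_mul_cancel₀ (pow_ne_zero _ hz)]
  have hsum : (r.map (z⁻¹ * ·)).sum = 0 := by
    rw [Multiset.sum_map_mul_left, Multiset.map_id', h0, mul_zero]
  obtain ⟨c, hcl⟩ := exists_sum_filter_pow_eq (p := 7) (m := 30) (by norm_num) (by norm_num)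
    (by norm_num) ht (zero_mem_cyclotomicSubfield_of_eq hsum)
  simp only [hsum, ite_self, add_zero, sum_map_inv_mul_filter r hz] at hcl
  have hcl' : ∀ η : ℂ, η ^ 7 = 1 → (r.filter fun y => y ^ 30 = (z * η) ^ 30).sum = z * η * c :=
    fun η hη => by
      have := hcl η hη
      rw [inv_mul_eq_iff_eq_mul₀ hz] at this
      rw [this]; ring
  have hc0 : c ≠ 0 := by
    rintro rfl
    have := hcl' 1 (one_pow _)
    rw [mul_one, mul_zero] at this
    exact hz30 this
  have hinj : ∀ w : ℂ, w ≠ 0 → Set.InjOn (fun η => (w * η) ^ 30)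
      (Polynomial.nthRootsFinset 7 (1 : ℂ)) := fun w hw a ha b hb hab => by
    simp only [mul_pow] at hab
    exact eq_of_pow_eq_pow_of_prime (p := 7) (by norm_num) (by norm_num : ¬ 7 ∣ 30)
      ((Polynomial.mem_nthRootsFinset (by norm_num) _).1 ha)
      ((Polynomial.mem_nthRootsFinset (by norm_num) _).1 hb)
      (mul_left_cancel₀ (pow_ne_zero _ hw) hab)
  have hdec : ∀ w : ℂ, w ^ 7 = z ^ 7 →
      ∑ η ∈ Polynomial.nthRootsFinset 7 (1 : ℂ), r.filter (fun y => y ^ 30 = (w * η) ^ 30) = r := by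
    intro w hw
    have hw0 : w ≠ 0 := by
      rintro rfl
      rw [zero_pow (by norm_num)] at hw
      exact pow_ne_zero 7 hz hw.symm
    refine r.sum_filter_fiber_eq (fun y => y ^ 30) _ _ (hinj w hw0) fun y hy => ?_
    obtain ⟨η, hη, h⟩ := exists_pow_eq_pow_of_pow_mul_eq_one (p := 7) (m := 30) (y := y / w)
      (by norm_num) (by norm_num) (by
        rw [div_pow, h210 y hy, pow_mul w, hw, ← pow_mul, div_self (pow_ne_zero _ hz)])
    refine ⟨η, (Polynomial.mem_nthRootsFinset (by norm_num) _).2 hη, ?_⟩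
    rw [mul_pow, ← h, div_pow, mul_div_cancel₀ _ (pow_ne_zero _ hw0)]
  -- Eight elements in seven cosets: some coset holds two. It is made the base point `w`; no coset
  -- sum vanishes, so every other coset holds exactly one element.
  obtain ⟨η₀, hη₀, hη2⟩ : ∃ η ∈ Polynomial.nthRootsFinset 7 (1 : ℂ),
      2 ≤ (r.filter fun y => y ^ 30 = (z * η) ^ 30).card := by
    by_contra! h
    have h1 := congrArg Multiset.card (hdec z rfl)
    rw [Multiset.card_sum, hc] at h1
    have h2 := Finset.sum_le_card_nsmul _ _ 1 fun η hη => Nat.le_of_lt_succ (h η hη)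
    rw [h1, nthRootsFinset_seven, Finset.card_insert_of_notMem (by
      rw [mem_primitiveRoots_seven]; simp), card_primitiveRoots_seven] at h2
    norm_num at h2
  replace hη₀ := (Polynomial.mem_nthRootsFinset (by norm_num) _).1 hη₀
  have hη₀0 : η₀ ≠ 0 := by rintro rfl; norm_num at hη₀
  obtain ⟨w, hw⟩ : ∃ w, w = z * η₀ := ⟨_, rfl⟩
  rw [← hw] at hη2
  have hw0 : w ≠ 0 := hw ▸ mul_ne_zero hz hη₀0
  have hw7 : w ^ 7 = z ^ 7 := by rw [hw, mul_pow, hη₀, mul_one]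
  have hclw : ∀ η : ℂ, η ^ 7 = 1 → (r.filter fun y => y ^ 30 = (w * η) ^ 30).sum = w * c * η :=
    fun η hη => by
      have := hcl' (η₀ * η) (by rw [mul_pow, hη₀, hη, one_mul])
      rw [← mul_assoc, ← hw] at this
      rw [this]; ring
  have hX0 : w * c ≠ 0 := mul_ne_zero hw0 hc0
  have hdecw := hdec w hw7
  rw [nthRootsFinset_seven, Finset.sum_insert (by rw [mem_primitiveRoots_seven]; simp),
    mul_one] at hdecw
  have hcards := congrArg Multiset.card hdecw
  rw [Multiset.card_add, Multiset.card_sum, hc] at hcards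
  have hge : ∀ ξ ∈ primitiveRoots 7 ℂ, 1 ≤ (r.filter fun y => y ^ 30 = (w * ξ) ^ 30).card := by
    intro ξ hξ
    have hξ7 := (mem_primitiveRoots_seven.1 hξ).1
    rw [Nat.one_le_iff_ne_zero]
    intro h
    have h1 := hclw ξ hξ7
    rw [Multiset.card_eq_zero.1 h, Multiset.sum_zero] at h1
    refine mul_ne_zero hX0 ?_ h1.symm
    rintro rfl
    norm_num at hξ7
  have h6 : 6 ≤ ∑ ξ ∈ primitiveRoots 7 ℂ, (r.filter fun y => y ^ 30 = (w * ξ) ^ 30).card := by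
    have := Finset.card_nsmul_le_sum _ _ 1 hge
    rwa [card_primitiveRoots_seven, smul_eq_mul, mul_one] at this
  have hsum6 : ∑ ξ ∈ primitiveRoots 7 ℂ, (r.filter fun y => y ^ 30 = (w * ξ) ^ 30).card =
      ∑ ξ ∈ primitiveRoots 7 ℂ, 1 := by
    rw [Finset.sum_const, card_primitiveRoots_seven, smul_eq_mul, mul_one]; omega
  have hone := (Finset.sum_eq_sum_iff_of_le hge).1 hsum6.symm
  have hsing : ∀ ξ ∈ primitiveRoots 7 ℂ, (r.filter fun y => y ^ 30 = (w * ξ) ^ 30) =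
      {w * c * ξ} := fun ξ hξ => by
    obtain ⟨a, ha⟩ := Multiset.card_eq_one.1 (hone ξ hξ).symm
    have h1 := hclw ξ (mem_primitiveRoots_seven.1 hξ).1
    rw [ha, Multiset.sum_singleton] at h1
    rw [ha, h1]
  have hXf : IsOfFinOrder (w * c) := by
    have hz7 : zeta 7 ∈ primitiveRoots 7 ℂ :=
      (mem_primitiveRoots (by norm_num)).2 (zeta_isPrimitiveRoot (by norm_num))
    have h1 : w * c * zeta 7 ∈ r :=
      (Multiset.mem_filter.1 (hsing _ hz7 ▸ Multiset.mem_singleton_self _ :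
        w * c * zeta 7 ∈ r.filter fun y => y ^ 30 = (w * zeta 7) ^ 30)).1
    refine isOfFinOrder_of_pow_eq_pow (n := 7) (by norm_num) (hr _ h1) ?_
    rw [mul_pow _ (zeta 7), (mem_primitiveRoots_seven.1 hz7).1, mul_one]
  obtain ⟨a, b, hab⟩ := Multiset.card_eq_two.1
    (by omega : (r.filter fun y => y ^ 30 = w ^ 30).card = 2)
  have hsumab := hclw 1 (one_pow _)
  rw [mul_one, hab, mul_one, Multiset.sum_pair] at hsumab
  have hamem : a ∈ r.filter fun y => y ^ 30 = w ^ 30 := by rw [hab]; simp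
  have hbmem : b ∈ r.filter fun y => y ^ 30 = w ^ 30 := by rw [hab]; simp
  obtain ⟨ω, hω, rfl, rfl⟩ := exists_cubeRoot_of_add_eq (hr a (Multiset.mem_filter.1 hamem).1)
    (hr b (Multiset.mem_filter.1 hbmem).1) hXf hsumab
  refine ⟨w * c, ω, hXf, hω, ?_⟩
  rw [Finset.sum_congr rfl hsing, sum_singleton_eq_map, hab] at hdecw
  rw [← hdecw, Multiset.insert_eq_cons, Multiset.cons_add, Multiset.singleton_add]

theorem not_pair_le {s : Multiset ℂ} (hs : Reduced s) {X ω : ℂ} (hX : IsOfFinOrder X)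
    (hω : IsPrimitiveRoot ω 3) : ¬ {-X * ω, -X * ω ^ 2} ≤ s := fun h => by
  refine hs.add_not_isOfFinOrder h ?_
  have hg := hω.geom_sum_eq_zero (by norm_num)
  simp only [Finset.sum_range_succ, Finset.sum_range_zero, pow_zero, pow_one, zero_add] at hg
  have : -X * ω + -X * ω ^ 2 = X := by linear_combination -X * hg
  rwa [this]

/-- Two reduced multisets of weight four with the same sum, but with different sums over some coset
of the `30`-th roots of unity, come from a relation between the seventh roots of unity. -/
theorem exists_septicForm_of_not_splitting {s t : Multiset ℂ} (hs : Reduced s) (ht : Reduced t)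
    (hc : s.card = 4) (hst : s.sum = t.sum) {x : ℂ}
    (hx : (s.filter fun y => y ^ 30 = x ^ 30).sum ≠ (t.filter fun y => y ^ 30 = x ^ 30).sum) :
    ∃ (X ω : ℂ) (A : Finset ℂ), X ≠ 0 ∧ IsPrimitiveRoot ω 3 ∧ A ⊆ primitiveRoots 7 ℂ ∧
      A.card = 3 ∧ s = septicForm X ω A ∧
      t = septicForm (-X) (ω ^ 2) (primitiveRoots 7 ℂ \ A) := by
  have hneg : Reduced (t.map (-1 * ·)) :=
    ht.map_mul (isOfFinOrder_of_pow_eq_one (n := 2) (by norm_num) (by norm_num))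
  simp only [neg_one_mul] at hneg
  have htc := hs.card_eq ht hst
  have hr : ∀ y ∈ s + t.map (-·), IsOfFinOrder y := fun y hy =>
    (Multiset.mem_add.1 hy).elim (hs.1 y) (hneg.1 y)
  have hsum0 : (s + t.map (-·)).sum = 0 := by
    rw [Multiset.sum_add, Multiset.sum_map_neg', hst]; simp
  have hfil : ∀ (m : ℕ) (w : ℂ), Even m → ((s + t.map (-·)).filter fun y => y ^ m = w ^ m) =
      (s.filter fun y => y ^ m = w ^ m) + (t.filter fun y => y ^ m = w ^ m).map (-·) :=
    fun m w hm => by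
      rw [Multiset.filter_add, Multiset.filter_map]
      congr 3
      funext y
      simp [hm.neg_pow]
  obtain ⟨z, hz, hzx⟩ : ∃ z ∈ s + t.map (-·), z ^ 30 = x ^ 30 := by
    by_contra! h
    have h1 := Multiset.filter_eq_nil.2 h
    rw [hfil 30 x (by decide)] at h1
    have h2 := congrArg Multiset.card h1
    rw [Multiset.card_add, Multiset.card_map, Multiset.card_zero] at h2
    refine hx ?_
    rw [Multiset.card_eq_zero.1 (by omega : (s.filter fun y => y ^ 30 = x ^ 30).card = 0),
      Multiset.card_eq_zero.1 (by omega : (t.filter fun y => y ^ 30 = x ^ 30).card = 0)]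
  have hz0 := isOfFinOrder_ne_zero (hr z hz)
  have hcard8 : (s + t.map (-·)).card = 8 := by
    rw [Multiset.card_add, Multiset.card_map, ← htc, hc]
  have hz30 : ((s + t.map (-·)).filter fun y => y ^ 30 = z ^ 30).sum ≠ 0 := by
    rw [hzx, hfil 30 x (by decide), Multiset.sum_add, Multiset.sum_map_neg', ← sub_eq_add_neg]
    exact sub_ne_zero.2 hx
  have h210 := sum_filter_pow_210_eq_zero hr hsum0 (by omega) z
  -- `s` and `t` contribute equally many terms to this coset, so its size is even; being at least
  -- `7`, it is all of `8`.
  have hPQ : (s.filter fun y => y ^ 210 = z ^ 210).card =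
      (t.filter fun y => y ^ 210 = z ^ 210).card := by
    refine (hs.filter _).card_eq (ht.filter _) ?_
    rw [hfil 210 z (by decide), Multiset.sum_add, Multiset.sum_map_neg', ← sub_eq_add_neg] at h210
    exact sub_eq_zero.1 h210
  have h7 : 7 ≤ ((s + t.map (-·)).filter fun y => y ^ 210 = z ^ 210).card := by
    by_contra! hlt
    have h1 := sum_filter_pow_eq_zero (p := 7) (m := 30) (by norm_num) (by norm_num)
      (fun y hy => isOfFinOrder_ne_zero (hr y (Multiset.mem_filter.1 hy).1))
      (fun y hy w hw => (Multiset.mem_filter.1 hy).2.trans (Multiset.mem_filter.1 hw).2.symm) h210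
      (Or.inr hlt) z
    rw [Multiset.filter_filter] at h1
    refine hz30 (Eq.trans ?_ h1)
    congr 1
    refine Multiset.filter_congr fun y _ => ⟨fun h => ⟨h, ?_⟩, fun h => h.1⟩
    rw [show 210 = 30 * 7 by norm_num, pow_mul, h, ← pow_mul]
  have hall : ∀ y ∈ s + t.map (-·), y ^ 210 = z ^ 210 := by
    refine Multiset.filter_eq_self.1 (Multiset.eq_of_le_of_card_le (Multiset.filter_le _ _) ?_)
    have e := congrArg Multiset.card (hfil 210 z (by decide))
    rw [Multiset.card_add, Multiset.card_map] at e
    omega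
  obtain ⟨X, ω, hXf, hω, hrX⟩ := exists_eq_cons_cons_map hr hcard8 hsum0 hz0 hall hz30
  have hX0 := isOfFinOrder_ne_zero hXf
  have hω3 : ω ^ 3 = 1 := hω.pow_eq_one
  have hω' : IsPrimitiveRoot (ω ^ 2) 3 := hω.pow_of_coprime 2 (by norm_num)
  have hω4 : (ω ^ 2) ^ 2 = ω := by linear_combination ω * hω3
  have hnegneg : (t.map (-·)).map (-·) = t := by
    rw [Multiset.map_map]; simp
  have hmem : -X * ω ∈ s + t.map (-·) := by rw [hrX]; exact Multiset.mem_cons_self _ _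
  have hmem2 : -X * ω ^ 2 ∈ s + t.map (-·) := by rw [hrX]; simp
  -- Replacing `ω` by `ω ^ 2` interchanges the two cases.
  by_cases h : -X * ω ∈ s
  · obtain ⟨A, hA, hA3, h1, h2⟩ :=
      exists_septicForm_of_add_eq hX0 hc hrX (not_pair_le hs hXf hω) h
    rw [hnegneg] at h2
    exact ⟨X, ω, A, hX0, hω, hA, hA3, h1, h2⟩
  · have h' : -X * ω ∈ t.map (-·) := (Multiset.mem_add.1 hmem).resolve_left h
    have h2 : -X * ω ^ 2 ∈ s := by
      refine (Multiset.mem_add.1 hmem2).resolve_right fun h2 => not_pair_le hneg hXf hω ?_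
      have hne : -X * ω ^ 2 ≠ -X * ω := fun he => by
        have h3 := mul_left_cancel₀ (neg_ne_zero.2 hX0) he
        exact hω.ne_one (by norm_num) (mul_left_cancel₀ (hω.ne_zero (by norm_num))
          (by rw [mul_one, ← pow_two, h3]))
      obtain ⟨u, hu⟩ := Multiset.exists_cons_of_mem h'
      rw [hu] at h2 ⊢
      obtain ⟨u', rfl⟩ := Multiset.exists_cons_of_mem ((Multiset.mem_cons.1 h2).resolve_left hne)
      exact Multiset.cons_le_cons _ (Multiset.cons_le_cons _ (Multiset.zero_le _))
    have hrX' : s + t.map (-·) = (-X * ω ^ 2) ::ₘ (-X * (ω ^ 2) ^ 2) ::ₘ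
        (primitiveRoots 7 ℂ).val.map (X * ·) := by
      rw [hω4, Multiset.cons_swap, hrX]
    obtain ⟨A, hA, hA3, h1, h2⟩ :=
      exists_septicForm_of_add_eq hX0 hc hrX' (not_pair_le hs hXf hω') h2
    rw [hnegneg] at h2
    exact ⟨X, ω ^ 2, A, hX0, hω', hA, hA3, h1, h2⟩

theorem neg_cubeRoot_ne_one {ω : ℂ} (hω : IsPrimitiveRoot ω 3) : -ω ≠ 1 := fun h => by
  have h1 : ω = -1 := by linear_combination -h
  have := hω.pow_eq_one
  rw [h1] at this
  norm_num at this

theorem map_pow_seven_septicForm {X ω : ℂ} {A : Finset ℂ} (hω : IsPrimitiveRoot ω 3)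
    (hA : A ⊆ primitiveRoots 7 ℂ) :
    (septicForm X ω A).map (· ^ 7) = (X ^ 7 * -ω) ::ₘ Multiset.replicate A.card (X ^ 7) := by
  rw [septicForm, Multiset.map_cons, Multiset.map_map]
  congr 1
  · have := hω.pow_eq_one
    rw [mul_pow, show ω ^ 7 = ω by linear_combination (ω ^ 4 + ω) * this]; ring
  · rw [Multiset.eq_replicate]
    refine ⟨by simp, fun y hy => ?_⟩
    obtain ⟨ξ, hξ, rfl⟩ := Multiset.mem_map.1 hy
    simp only [Function.comp_apply]
    rw [mul_pow, (mem_primitiveRoots_seven.1 (hA hξ)).1, mul_one]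

/-- Seventh powers collapse the three `X * ξ` to a triple `X ^ 7` and leave a factor `-ω ≠ 1` on the
fourth element. The multiplicities give `X ^ 7` and `ω`, and the fourth element then gives `X`. -/
theorem septicForm_inj {X X' ω ω' : ℂ} {A A' : Finset ℂ} (hX : X ≠ 0)
    (hω : IsPrimitiveRoot ω 3) (hω' : IsPrimitiveRoot ω' 3) (hA : A ⊆ primitiveRoots 7 ℂ)
    (hA' : A' ⊆ primitiveRoots 7 ℂ) (hc : A.card = 3) (hc' : A'.card = 3)
    (h : septicForm X ω A = septicForm X' ω' A') : X = X' ∧ ω = ω' ∧ A = A' := by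
  classical
  have h7 := congrArg (Multiset.map (· ^ 7)) h
  rw [map_pow_seven_septicForm hω hA, map_pow_seven_septicForm hω' hA', hc, hc'] at h7
  have hX7 : X ^ 7 = X' ^ 7 := by
    by_contra hne
    have h1 := congrArg (Multiset.count (X ^ 7)) h7
    rw [Multiset.count_cons, Multiset.count_cons, Multiset.count_replicate_self,
      Multiset.count_replicate, if_neg (Ne.symm hne)] at h1
    split_ifs at h1 <;> omega
  rw [hX7, Multiset.cons_inj_left] at h7
  have hX70 : X' ^ 7 ≠ 0 := hX7 ▸ pow_ne_zero 7 hX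
  have hωω : ω = ω' := neg_injective (mul_left_cancel₀ hX70 h7)
  subst hωω
  have hXX : X = X' := by
    have hmem : -X * ω ∈ septicForm X' ω A' := h ▸ Multiset.mem_cons_self _ _
    rcases Multiset.mem_cons.1 hmem with h1 | h1
    · exact neg_injective (mul_right_cancel₀ (hω.ne_zero (by norm_num)) h1)
    · exfalso
      obtain ⟨ξ, hξ, h2⟩ := Multiset.mem_map.1 h1
      have h3 : (X' * ξ) ^ 7 = (-X * ω) ^ 7 := congrArg (· ^ 7) h2
      have h4 := hω.pow_eq_one
      rw [mul_pow, (mem_primitiveRoots_seven.1 (hA' hξ)).1, mul_one, mul_pow,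
        show ω ^ 7 = ω by linear_combination (ω ^ 4 + ω) * h4] at h3
      refine neg_cubeRoot_ne_one hω (mul_left_cancel₀ hX70 ?_)
      rw [mul_one]
      nth_rw 2 [h3]
      rw [← hX7]; ring
  subst hXX
  refine ⟨rfl, rfl, Finset.val_injective ?_⟩
  rw [septicForm, septicForm, Multiset.cons_inj_right] at h
  exact Multiset.map_injective (mul_right_injective₀ hX) h

/-! ### The stabiliser in the exceptional case. -/

section SepticStabiliser

theorem odd_val_unit {N : ℕ} (h2 : 2 ∣ N) (k : (ZMod N)ˣ) : Odd k.val.val := by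
  rw [← Nat.not_even_iff_odd, even_iff_two_dvd]
  intro h
  have h1 := Nat.dvd_gcd h h2
  rw [(ZMod.val_coe_unit_coprime k).gcd_eq_one] at h1
  omega

variable {N : ℕ} [NeZero N] {H : Subgroup (ZMod N)ˣ} {s : Multiset ℂ} {X ω : ℂ} {A : Finset ℂ}

theorem map_pow_septicForm {k : ℕ} (hk2 : Odd k) (hk7 : k.Coprime 7)
    (hA : A ⊆ primitiveRoots 7 ℂ) :
    (septicForm X ω A).map (· ^ k) = septicForm (X ^ k) (ω ^ k) (A.image (· ^ k)) := by
  have hinj : Set.InjOn (· ^ k) (A : Set ℂ) := fun a ha b hb hab =>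
    eq_of_pow_eq_pow_of_prime (p := 7) (by norm_num)
      ((Nat.Prime.coprime_iff_not_dvd (by norm_num)).1 hk7.symm)
      (mem_primitiveRoots_seven.1 (hA ha)).1 (mem_primitiveRoots_seven.1 (hA hb)).1 hab
  rw [septicForm, septicForm, Multiset.map_cons, Multiset.map_map,
    Finset.image_val_of_injOn hinj, Multiset.map_map]
  congr 1
  · rw [mul_pow, hk2.neg_pow]
  · exact Multiset.map_congr rfl fun ξ _ => mul_pow _ _ _

theorem pow_mem_primitiveRoots_seven {k : ℕ} (hk7 : k.Coprime 7) {ξ : ℂ}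
    (hξ : ξ ∈ primitiveRoots 7 ℂ) : ξ ^ k ∈ primitiveRoots 7 ℂ :=
  (mem_primitiveRoots (by norm_num)).2
    (((mem_primitiveRoots (by norm_num)).1 hξ).pow_of_coprime k hk7)

/-- The elements `X * ξ` lie in different cosets because `7 ∤ 30`, and `-X * ω` adds at most one.
This makes uniqueness coset by coset available. -/
theorem card_filter_septicForm_le (hX : X ≠ 0)
    (hA : A ⊆ primitiveRoots 7 ℂ) (z : ℂ) :
    ((septicForm X ω A).filter fun y => y ^ 30 = z ^ 30).card ≤ 2 := by
  have h1 : ((septicForm X ω A).filter fun y => y ^ 30 = z ^ 30).card =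
      ((septicForm X ω A).map (· ^ 30)).count (z ^ 30) := by
    rw [Multiset.count_map]
    exact congrArg Multiset.card (Multiset.filter_congr fun y _ => eq_comm)
  rw [h1, septicForm, Multiset.map_cons, Multiset.map_map]
  have hnodup : (A.val.map ((· ^ 30) ∘ (X * ·))).Nodup := by
    refine Multiset.Nodup.map_on (fun a ha b hb hab => ?_) A.nodup
    have hab : (X * a) ^ 30 = (X * b) ^ 30 := hab
    rw [mul_pow, mul_pow] at hab
    have ha7 := (mem_primitiveRoots_seven.1 (hA (Finset.mem_def.2 ha))).1
    have hb7 := (mem_primitiveRoots_seven.1 (hA (Finset.mem_def.2 hb))).1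
    have hab' : a ^ 30 = b ^ 30 := mul_left_cancel₀ (pow_ne_zero 30 hX) hab
    exact eq_of_pow_eq_pow_of_prime (p := 7) (m := 30) (by norm_num) (by norm_num) ha7 hb7 hab'
  have h2 := Multiset.nodup_iff_count_le_one.1 hnodup (z ^ 30)
  rw [Multiset.count_cons]
  split_ifs <;> omega

theorem dvd_of_pow_septicForm_eq_one (h2 : 2 ∣ N) (hω : IsPrimitiveRoot ω 3)
    (hX : X ≠ 0) (hA : A ⊆ primitiveRoots 7 ℂ) (hc : 1 < A.card)
    (hN : ∀ y ∈ septicForm X ω A, y ^ N = 1) : 7 ∣ N ∧ 3 ∣ N ∧ X ^ N = 1 := by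
  obtain ⟨ξ, hξ, η, hη, hne⟩ := Finset.one_lt_card.1 hc
  have e1 : (X * ξ) ^ N = 1 := hN _ (Multiset.mem_cons_of_mem (Multiset.mem_map_of_mem _ hξ))
  have e2 : (X * η) ^ N = 1 := hN _ (Multiset.mem_cons_of_mem (Multiset.mem_map_of_mem _ hη))
  have e3 : (-X * ω) ^ N = 1 := hN _ (Multiset.mem_cons_self _ _)
  have hξ7 := (mem_primitiveRoots_seven.1 (hA hξ)).1
  have hη7 := (mem_primitiveRoots_seven.1 (hA hη)).1
  have h7 : 7 ∣ N := by
    by_contra h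
    refine hne (eq_of_pow_eq_pow_of_prime (p := 7) (by norm_num) h hξ7 hη7 ?_)
    rw [mul_pow] at e1 e2
    exact mul_left_cancel₀ (pow_ne_zero N hX) (e1.trans e2.symm)
  have hXN : X ^ N = 1 := by
    obtain ⟨d, rfl⟩ := h7
    rwa [mul_pow, pow_mul ξ, hξ7, one_pow, mul_one] at e1
  refine ⟨h7, hω.dvd_of_pow_eq_one N ?_, hXN⟩
  rwa [mul_pow, (even_iff_two_dvd.2 h2).neg_pow, hXN, one_mul] at e3

/-- The alternative for the action of an element `k` of the stabiliser on the data `X`, `ω`, `A`. -/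
theorem septic_stabiliser_cases (h2 : 2 ∣ N) (hs : Reduced (septicForm X ω A)) (hX : X ≠ 0)
    (hω : IsPrimitiveRoot ω 3) (hA : A ⊆ primitiveRoots 7 ℂ) (hc : A.card = 3)
    (hN : ∀ y ∈ septicForm X ω A, y ^ N = 1) {k : (ZMod N)ˣ}
    (hk : ((septicForm X ω A).map (· ^ k.val.val)).sum = (septicForm X ω A).sum) :
    (X ^ k.val.val = X ∧ ω ^ k.val.val = ω ∧
      ∀ ξ ∈ primitiveRoots 7 ℂ, ξ ^ k.val.val ∈ A ↔ ξ ∈ A) ∨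
    (X ^ k.val.val = -X ∧ ω ^ k.val.val = ω ^ 2 ∧
      ∀ ξ ∈ primitiveRoots 7 ℂ, ξ ^ k.val.val ∈ A ↔ ξ ∉ A) := by
  classical
  obtain ⟨h7, h3, -⟩ := dvd_of_pow_septicForm_eq_one h2 hω hX hA (by omega) hN
  have hcop := ZMod.val_coe_unit_coprime k
  have hk7 := hcop.of_dvd_right h7
  have hk3 := hcop.of_dvd_right h3
  have hodd := odd_val_unit h2 k
  have hred : Reduced ((septicForm X ω A).map (· ^ k.val.val)) :=
    hs.of_card_eq (fun y hy => by
      obtain ⟨w, hw, rfl⟩ := Multiset.mem_map.1 hy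
      exact (hs.1 w hw).pow) hk (Multiset.card_map _ _)
  generalize k.val.val = n at *
  have hinj : ∀ a ∈ primitiveRoots 7 ℂ, ∀ b ∈ primitiveRoots 7 ℂ, a ^ n = b ^ n → a = b :=
    fun a ha b hb hab => eq_of_pow_eq_pow_of_prime (p := 7) (by norm_num)
      ((Nat.Prime.coprime_iff_not_dvd (by norm_num)).1 hk7.symm)
      (mem_primitiveRoots_seven.1 ha).1 (mem_primitiveRoots_seven.1 hb).1 hab
  have hAn : A.image (· ^ n) ⊆ primitiveRoots 7 ℂ := fun y hy => by
    obtain ⟨ξ, hξ, rfl⟩ := Finset.mem_image.1 hy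
    exact pow_mem_primitiveRoots_seven hk7 (hA hξ)
  have hcn : (A.image (· ^ n)).card = 3 := by
    rw [Finset.card_image_of_injOn fun a ha b hb hab => hinj a (hA ha) b (hA hb) hab, hc]
  have hmem : ∀ ξ ∈ primitiveRoots 7 ℂ, ξ ^ n ∈ A.image (· ^ n) ↔ ξ ∈ A := fun ξ hξ =>
    ⟨fun h => by
      obtain ⟨η, hη, h⟩ := Finset.mem_image.1 h
      rwa [← hinj η (hA hη) ξ hξ h], fun h => Finset.mem_image_of_mem _ h⟩
  have hωn := hω.pow_of_coprime n hk3
  have hXn : X ^ n ≠ 0 := pow_ne_zero n hX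
  have hmap := map_pow_septicForm (X := X) (ω := ω) hodd hk7 hA
  -- If the relation splits, `s` equals its image. If not, the two are complementary parts of one
  -- relation, whose data are determined by `septicForm_inj`.
  by_cases hsplit : ∀ x : ℂ, ((septicForm X ω A).filter fun y => y ^ 30 = x ^ 30).sum =
      (((septicForm X ω A).map (· ^ n)).filter fun y => y ^ 30 = x ^ 30).sum
  · left
    have h := eq_of_forall_sum_filter_eq hs hred hsplit
      fun z _ => card_filter_septicForm_le hX hA z
    rw [hmap] at h
    obtain ⟨e1, e2, e3⟩ := septicForm_inj hX hω hωn hA hAn hc hcn h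
    refine ⟨e1.symm, e2.symm, fun ξ hξ => ?_⟩
    rw [← hmem ξ hξ, ← e3]
  · right
    push Not at hsplit
    obtain ⟨x, hx⟩ := hsplit
    obtain ⟨X', ω', A', hX', hω', hA', hc', e1, e2⟩ := exists_septicForm_of_not_splitting hs hred
      (by rw [card_septicForm, hc]) hk.symm hx
    obtain ⟨rfl, rfl, rfl⟩ := septicForm_inj hX hω hω' hA hA' hc hc' e1
    rw [hmap] at e2
    obtain ⟨e3, e4, e5⟩ := septicForm_inj hXn hωn (hω.pow_of_coprime 2 (by norm_num)) hAn
      Finset.sdiff_subset hcn (by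
        rw [Finset.card_sdiff_of_subset hA, card_primitiveRoots_seven, hc]) e2
    refine ⟨e3, e4, fun ξ hξ => ?_⟩
    have h1 := hmem ξ hξ
    rw [e5, Finset.mem_sdiff] at h1
    have h2 := pow_mem_primitiveRoots_seven hk7 hξ
    tauto

theorem val_modEq_of_unitsMap_eq {M : ℕ} (hMN : M ∣ N) {k : (ZMod N)ˣ} {r : ℕ}
    (h : ((ZMod.unitsMap hMN k : (ZMod M)ˣ) : ZMod M) = r) : k.val.val ≡ r [MOD M] := by
  rw [← ZMod.natCast_eq_natCast_iff, ← h, ZMod.unitsMap_val, ZMod.natCast_val]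

/-- A power map congruent to `1` modulo `7` fixes each `ξ`, so it cannot exchange `A` with its
complement; hence it fixes `X` and `ω` too. -/
theorem unitsMap_seven_injective (h2 : 2 ∣ N) (hs : Reduced (septicForm X ω A)) (hX : X ≠ 0)
    (hω : IsPrimitiveRoot ω 3) (hA : A ⊆ primitiveRoots 7 ℂ) (hc : A.card = 3)
    (hN : ∀ y ∈ septicForm X ω A, y ^ N = 1) (h7 : 7 ∣ N)
    (hsum : ∀ k ∈ H, ((septicForm X ω A).map (· ^ k.val.val)).sum = (septicForm X ω A).sum)
    (hfaith : ∀ k ∈ H, (∀ y ∈ septicForm X ω A, y ^ k.val.val = y) → k = 1) :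
    Function.Injective ((ZMod.unitsMap h7).comp H.subtype) := by
  rw [injective_iff_map_eq_one]
  intro k hk
  have hk1 : k.1.val.val ≡ 1 [MOD 7] := val_modEq_of_unitsMap_eq h7 (by
    rw [Nat.cast_one]
    exact congrArg Units.val hk)
  have hpow : ∀ ξ ∈ primitiveRoots 7 ℂ, ξ ^ k.1.val.val = ξ := fun ξ hξ => by
    rw [pow_eq_pow_of_modEq hk1 (mem_primitiveRoots_seven.1 hξ).1, pow_one]
  have hodd := odd_val_unit h2 k.1
  refine Subtype.ext (hfaith k.1 k.2 fun y hy => ?_)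
  rcases septic_stabiliser_cases h2 hs hX hω hA hc hN (hsum k.1 k.2) with
    ⟨e1, e2, -⟩ | ⟨-, -, e3⟩
  · rcases Multiset.mem_cons.1 hy with rfl | hy
    · rw [mul_pow, hodd.neg_pow, e1, e2]
    · obtain ⟨ξ, hξ, rfl⟩ := Multiset.mem_map.1 hy
      rw [mul_pow, e1, hpow ξ (hA hξ)]
  · exfalso
    obtain ⟨ξ, hξ⟩ := Finset.card_pos.1 (by omega : 0 < A.card)
    have := e3 ξ (hA hξ)
    rw [hpow ξ (hA hξ)] at this
    tauto

theorem card_units_seven : Nat.card (ZMod 7)ˣ = 6 := by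
  rw [Nat.card_eq_fintype_card, ZMod.card_units_eq_totient]; decide

theorem eq_insert_of_pow_mem {ξ : ℂ} (hA : A ⊆ primitiveRoots 7 ℂ) (hc : A.card = 3)
    (hξ : ξ ∈ A) (h2 : ξ ^ 2 ∈ A) (h4 : ξ ^ 4 ∈ A) : A = {ξ, ξ ^ 2, ξ ^ 4} := by
  have hp := (mem_primitiveRoots (by norm_num)).1 (hA hξ)
  have hne : ∀ i < 7, ∀ j < 7, i ≠ j → ξ ^ i ≠ ξ ^ j := fun i hi j hj hij h =>
    hij (hp.pow_inj hi hj h)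
  have h12 := hne 1 (by norm_num) 2 (by norm_num) (by norm_num)
  have h14 := hne 1 (by norm_num) 4 (by norm_num) (by norm_num)
  have h24 := hne 2 (by norm_num) 4 (by norm_num) (by norm_num)
  rw [pow_one] at h12 h14
  symm
  refine Finset.eq_of_subset_of_card_le ?_ ?_
  · intro y hy
    simp only [Finset.mem_insert, Finset.mem_singleton] at hy
    rcases hy with rfl | rfl | rfl <;> assumption
  · rw [hc, Finset.card_insert_of_notMem (by simp [h12, h14]),
      Finset.card_insert_of_notMem (by simp [h24]), Finset.card_singleton]

/-- `X ^ k₃ = -X` with `k₃` odd excludes orders not divisible by `4`. A power of `X` of order `3`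
would be squared by `k₃`, yet `k₃` only changes its sign at most; one of order `7` would be squared
by `k₂`, which fixes `X`. -/
theorem order_conditions {k₂ k₃ : ℕ} (hX : IsOfFinOrder X) (hk₃ : Odd k₃)
    (h2 : k₂ ≡ 2 [MOD 7]) (hX2 : X ^ k₂ = X)
    (hX3 : X ^ k₃ = -X) (hω : IsPrimitiveRoot ω 3) (hω3 : ω ^ k₃ = ω ^ 2) :
    4 ∣ orderOf X ∧ ¬ 3 ∣ orderOf X ∧ ¬ 7 ∣ orderOf X := by
  have hpos := hX.orderOf_pos
  have hX0 := isOfFinOrder_ne_zero hX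
  have hprim : IsPrimitiveRoot X (orderOf X) := IsPrimitiveRoot.orderOf X
  have hX1 := pow_orderOf_eq_one X
  generalize orderOf X = m at *
  refine ⟨?_, ?_, ?_⟩
  · by_contra h4
    rcases Nat.even_or_odd m with he | ho
    · obtain ⟨j, rfl⟩ := he
      have hj : Odd j := by
        rw [← Nat.not_even_iff_odd]
        rintro ⟨i, rfl⟩
        exact h4 ⟨i, by ring⟩
      have h1 : X ^ j = -1 :=
        (hprim.pow hpos (by ring : j + j = j * 2)).eq_neg_one_of_two_right
      have h3 : (X ^ k₃) ^ j = (-X) ^ j := congrArg (· ^ j) hX3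
      rw [← pow_mul, mul_comm, pow_mul, h1, hj.neg_pow, h1, hk₃.neg_one_pow] at h3
      norm_num at h3
    · have h3 : (X ^ k₃) ^ m = (-X) ^ m := congrArg (· ^ m) hX3
      rw [← pow_mul, mul_comm, pow_mul, hX1, one_pow, ho.neg_pow, hX1] at h3
      norm_num at h3
  · rintro ⟨j, rfl⟩
    have h1 : IsPrimitiveRoot (X ^ j) 3 := hprim.pow hpos (by ring)
    obtain ⟨i, hi, h3⟩ := hω.eq_pow_of_pow_eq_one h1.pow_eq_one
    have h4 : (X ^ j) ^ k₃ = (X ^ j) ^ 2 := by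
      rw [← h3, ← pow_mul, mul_comm, pow_mul, hω3, ← pow_mul, mul_comm, pow_mul]
    rw [← pow_mul, mul_comm, pow_mul, hX3, neg_pow, pow_two] at h4
    have h5 := mul_right_cancel₀ (pow_ne_zero j hX0) h4
    have h6 := h1.pow_eq_one
    rcases neg_one_pow_eq_or ℂ j with h7 | h7
    · exact h1.ne_one (by norm_num) (h5.symm.trans h7)
    · rw [← h5, h7] at h6
      norm_num at h6
  · rintro ⟨j, rfl⟩
    have h1 : IsPrimitiveRoot (X ^ j) 7 := hprim.pow hpos (by ring)
    have h3 : (X ^ j) ^ k₂ = X ^ j := by rw [← pow_mul, mul_comm, pow_mul, hX2]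
    rw [pow_eq_pow_of_modEq h2 h1.pow_eq_one, pow_two] at h3
    exact h1.ne_one (by norm_num)
      (mul_right_cancel₀ (pow_ne_zero j hX0) (h3.trans (one_mul _).symm))

theorem exists_eq_zeta_six_pow (hω : IsPrimitiveRoot ω 3) :
    ∃ c : ℕ, c.Coprime 6 ∧ zeta 6 ^ c = -ω := by
  have hω3 : ω ^ 3 = 1 := hω.pow_eq_one
  have hz := zeta_isPrimitiveRoot (n := 6) (by norm_num)
  have hord : orderOf (-ω) = 6 := by
    refine orderOf_eq_of_pow_and_pow_div_prime (by norm_num) ?_ ?_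
    · linear_combination (ω ^ 3 + 1) * hω3
    · intro p hp hd
      have : p = 2 ∨ p = 3 := by
        have h1 : p ∣ 2 * 3 := hd
        rcases (Nat.Prime.dvd_mul hp).1 h1 with h | h
        · exact Or.inl ((Nat.prime_dvd_prime_iff_eq hp (by norm_num)).1 h)
        · exact Or.inr ((Nat.prime_dvd_prime_iff_eq hp (by norm_num)).1 h)
      rcases this with rfl | rfl
      · intro h
        have h1 : (-ω) ^ 3 = 1 := h
        have h2 : (-1 : ℂ) = 1 := by linear_combination h1 + hω3
        norm_num at h2
      · intro h
        have h1 : (-ω) ^ 2 = 1 := h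
        exact hω.ne_one (by norm_num) (by linear_combination hω3 - ω * h1)
  have hp : IsPrimitiveRoot (-ω) 6 := IsPrimitiveRoot.iff_orderOf.2 hord
  obtain ⟨c, -, hc⟩ := hz.eq_pow_of_pow_eq_one hp.pow_eq_one
  exact ⟨c, (hz.pow_iff_coprime (by norm_num) c).1 (hc ▸ hp), hc⟩

/-- The shape of `X`, `ω`, `A` if the stabiliser has six elements. -/
theorem exists_eq_of_card_eq_six (h2 : 2 ∣ N) (hs : Reduced (septicForm X ω A)) (hX : X ≠ 0)
    (hω : IsPrimitiveRoot ω 3) (hA : A ⊆ primitiveRoots 7 ℂ) (hc : A.card = 3)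
    (hN : ∀ y ∈ septicForm X ω A, y ^ N = 1)
    (hsum : ∀ k ∈ H, ((septicForm X ω A).map (· ^ k.val.val)).sum = (septicForm X ω A).sum)
    (hfaith : ∀ k ∈ H, (∀ y ∈ septicForm X ω A, y ^ k.val.val = y) → k = 1)
    (hcard : Nat.card H = 6) :
    ∃ (ε : ℂ) (c a : ℕ), IsOfFinOrder ε ∧ 4 ∣ orderOf ε ∧ ¬ 3 ∣ orderOf ε ∧
      ¬ 7 ∣ orderOf ε ∧ c.Coprime 6 ∧ a.Coprime 7 ∧ (septicForm X ω A).sum =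
        ε * (zeta 6 ^ c + zeta 7 ^ a + zeta 7 ^ (2 * a) + zeta 7 ^ (4 * a)) := by
  obtain ⟨h7, -, hXN⟩ := dvd_of_pow_septicForm_eq_one h2 hω hX hA (by omega) hN
  have hXf : IsOfFinOrder X := isOfFinOrder_of_pow_eq_one (NeZero.pos N) hXN
  have hinj := unitsMap_seven_injective h2 hs hX hω hA hc hN h7 hsum hfaith
  have hbij := hinj.bijective_of_nat_card_le (by rw [card_units_seven, hcard])
  have hex : ∀ r : ℕ, r.Coprime 7 → ∃ k ∈ H, k.val.val ≡ r [MOD 7] := fun r hr => by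
    obtain ⟨k, hk⟩ := hbij.2 (ZMod.unitOfCoprime r hr)
    exact ⟨k.1, k.2, val_modEq_of_unitsMap_eq h7 (congrArg Units.val hk)⟩
  -- `2` has order `3` modulo `7`, and `3` is a non-residue.
  obtain ⟨k₂, hk₂, hr₂⟩ := hex 2 (by norm_num)
  obtain ⟨k₃, hk₃, hr₃⟩ := hex 3 (by norm_num)
  have c₂ := septic_stabiliser_cases h2 hs hX hω hA hc hN (hsum k₂ hk₂)
  have c₃ := septic_stabiliser_cases h2 hs hX hω hA hc hN (hsum k₃ hk₃)
  have hodd₃ := odd_val_unit h2 k₃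
  generalize k₂.val.val = n₂ at *
  generalize k₃.val.val = n₃ at *
  have hp2 : ∀ ξ ∈ primitiveRoots 7 ℂ, ξ ^ n₂ = ξ ^ 2 := fun ξ hξ =>
    pow_eq_pow_of_modEq hr₂ (mem_primitiveRoots_seven.1 hξ).1
  have hp3 : ∀ ξ ∈ primitiveRoots 7 ℂ, ξ ^ n₃ = ξ ^ 3 := fun ξ hξ =>
    pow_eq_pow_of_modEq hr₃ (mem_primitiveRoots_seven.1 hξ).1
  obtain ⟨ξ, hξ⟩ := Finset.card_pos.1 (by omega : 0 < A.card)
  have hξp := hA hξ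
  have hξ7 := (mem_primitiveRoots_seven.1 hξp).1
  have hξ2 : ξ ^ 2 ∈ primitiveRoots 7 ℂ := pow_mem_primitiveRoots_seven (by norm_num) hξp
  have hξ4 : ξ ^ 4 ∈ primitiveRoots 7 ℂ := pow_mem_primitiveRoots_seven (by norm_num) hξp
  have e4 : (ξ ^ 2) ^ 2 = ξ ^ 4 := by ring
  have e8 : (ξ ^ 4) ^ 2 = ξ := by linear_combination ξ * hξ7
  rcases c₂ with ⟨hX2, -, hA2⟩ | ⟨-, -, hA2⟩
  swap
  -- The orbit `ξ, ξ ^ 2, ξ ^ 4` has odd length, so membership in `A` cannot alternate along it.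
  · exfalso
    have f1 := hA2 ξ hξp
    have f2 := hA2 _ hξ2
    have f3 := hA2 _ hξ4
    rw [hp2 _ hξp] at f1
    rw [hp2 _ hξ2, e4] at f2
    rw [hp2 _ hξ4, e8] at f3
    tauto
  have f1 := hA2 ξ hξp
  have f2 := hA2 _ hξ2
  rw [hp2 _ hξp] at f1
  rw [hp2 _ hξ2, e4] at f2
  have hAeq := eq_insert_of_pow_mem hA hc hξ (f1.2 hξ) (f2.2 (f1.2 hξ))
  have hprim := (mem_primitiveRoots (by norm_num)).1 hξp
  have hne : ∀ i < 7, ∀ j < 7, i ≠ j → ξ ^ i ≠ ξ ^ j := fun i hi j hj hij h =>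
    hij (hprim.pow_inj hi hj h)
  have h12 := hne 1 (by norm_num) 2 (by norm_num) (by norm_num)
  have h14 := hne 1 (by norm_num) 4 (by norm_num) (by norm_num)
  have h13 := hne 1 (by norm_num) 3 (by norm_num) (by norm_num)
  have h23 := hne 2 (by norm_num) 3 (by norm_num) (by norm_num)
  have h34 := hne 3 (by norm_num) 4 (by norm_num) (by norm_num)
  have h24 := hne 2 (by norm_num) 4 (by norm_num) (by norm_num)
  rw [pow_one] at h12 h13 h14
  rcases c₃ with ⟨-, -, hA3⟩ | ⟨hX3, hω3, -⟩
  · exfalso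
    have h3 := (hA3 ξ hξp).2 hξ
    rw [hp3 _ hξp, hAeq] at h3
    simp only [Finset.mem_insert, Finset.mem_singleton] at h3
    rcases h3 with h3 | h3 | h3
    · exact h13 h3.symm
    · exact h23 h3.symm
    · exact h34 h3
  obtain ⟨o4, o3, o7⟩ := order_conditions hXf hodd₃ hr₂ hX2 hX3 hω hω3
  obtain ⟨c, hc6, hcω⟩ := exists_eq_zeta_six_pow hω
  have hz := zeta_isPrimitiveRoot (n := 7) (by norm_num)
  obtain ⟨a, -, rfl⟩ := hz.eq_pow_of_pow_eq_one hξ7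
  refine ⟨X, c, a, hXf, o4, o3, o7, hc6, (hz.pow_iff_coprime (by norm_num) a).1 hprim, ?_⟩
  rw [sum_septicForm, hcω, hAeq, Finset.sum_insert (by simp [h12, h14]),
    Finset.sum_insert (by simp [h24]), Finset.sum_singleton, ← pow_mul, ← pow_mul, mul_comm a 2,
    mul_comm a 4]
  ring

end SepticStabiliser

/-! ### Elements with a stabiliser of order six. -/

section Converse

variable {N : ℕ} [NeZero N] {X ω ξ : ℂ}

theorem exists_unit_modEq {m r e f : ℕ} (hm3 : ¬ 3 ∣ m) (hm7 : ¬ 7 ∣ m) (hm : m ∣ N) (h3 : 3 ∣ N)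
    (h7 : 7 ∣ N) (hr : r.Coprime 7) (he : e.Coprime 3) (hf : f.Coprime m) :
    ∃ k : (ZMod N)ˣ, k.val.val ≡ r [MOD 7] ∧ k.val.val ≡ e [MOD 3] ∧ k.val.val ≡ f [MOD m] := by
  have hc3 : Nat.Coprime 3 m := (Nat.Prime.coprime_iff_not_dvd (by norm_num)).2 hm3
  have hc7 : Nat.Coprime 7 (3 * m) :=
    Nat.Coprime.mul_right (by norm_num) ((Nat.Prime.coprime_iff_not_dvd (by norm_num)).2 hm7)
  obtain ⟨a, ha3, ham⟩ := Nat.chineseRemainder hc3 e f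
  obtain ⟨b, hb7, hb⟩ := Nat.chineseRemainder hc7 r a
  have hb3 : b ≡ e [MOD 3] := (hb.of_mul_right m).trans ha3
  have hbm : b ≡ f [MOD m] := (hb.of_mul_left 3).trans ham
  have hcop : b.Coprime (7 * (3 * m)) := by
    refine Nat.Coprime.mul_right ?_ (Nat.Coprime.mul_right ?_ ?_)
    · exact hb7.gcd_eq.trans hr
    · exact hb3.gcd_eq.trans he
    · exact hbm.gcd_eq.trans hf
  have hdvd : 7 * (3 * m) ∣ N :=
    hc7.mul_dvd_of_dvd_of_dvd h7 (hc3.mul_dvd_of_dvd_of_dvd h3 hm)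
  obtain ⟨k, hk⟩ := ZMod.unitsMap_surjective hdvd (ZMod.unitOfCoprime b hcop)
  have hkb : k.val.val ≡ b [MOD 7 * (3 * m)] := val_modEq_of_unitsMap_eq hdvd (by
    rw [hk, ZMod.coe_unitOfCoprime])
  exact ⟨k, (hkb.of_mul_right _).trans hb7, ((hkb.of_mul_left 7).of_mul_right m).trans hb3,
    ((hkb.of_mul_left 7).of_mul_left 3).trans hbm⟩

theorem sum_map_pow_septicForm {k : ℕ} (A : Finset ℂ) :
    ((septicForm X ω A).map (· ^ k)).sum = (-X * ω) ^ k + X ^ k * ∑ η ∈ A, η ^ k := by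
  rw [septicForm, Multiset.map_cons, Multiset.sum_cons, Multiset.map_map]
  simp only [Function.comp_def, mul_pow]
  rw [Multiset.sum_map_mul_left]
  rfl

theorem sum_pow_triple (hξ : ξ ∈ primitiveRoots 7 ℂ) (k : ℕ) :
    ∑ η ∈ ({ξ, ξ ^ 2, ξ ^ 4} : Finset ℂ), η ^ k = ξ ^ k + (ξ ^ k) ^ 2 + (ξ ^ k) ^ 4 := by
  have hprim := (mem_primitiveRoots (by norm_num)).1 hξ
  have hne : ∀ i < 7, ∀ j < 7, i ≠ j → ξ ^ i ≠ ξ ^ j := fun i hi j hj hij h =>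
    hij (hprim.pow_inj hi hj h)
  have h12 := hne 1 (by norm_num) 2 (by norm_num) (by norm_num)
  have h14 := hne 1 (by norm_num) 4 (by norm_num) (by norm_num)
  have h24 := hne 2 (by norm_num) 4 (by norm_num) (by norm_num)
  rw [pow_one] at h12 h14
  rw [Finset.sum_insert (by simp [h12, h14]), Finset.sum_insert (by simp [h24]),
    Finset.sum_singleton, ← pow_mul, ← pow_mul, ← pow_mul, ← pow_mul, mul_comm 2, mul_comm 4,
    add_assoc]

theorem card_triple (hξ : ξ ∈ primitiveRoots 7 ℂ) : ({ξ, ξ ^ 2, ξ ^ 4} : Finset ℂ).card = 3 := by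
  -- With exponent `0` the sum counts the elements.
  have h := sum_pow_triple hξ 0
  simp only [pow_zero, one_pow, Finset.sum_const, nsmul_eq_mul, mul_one] at h
  have : ((({ξ, ξ ^ 2, ξ ^ 4} : Finset ℂ).card : ℕ) : ℂ) = (3 : ℕ) := by rw [h]; norm_num
  exact_mod_cast this

theorem triple_subset (hξ : ξ ∈ primitiveRoots 7 ℂ) :
    ({ξ, ξ ^ 2, ξ ^ 4} : Finset ℂ) ⊆ primitiveRoots 7 ℂ := by
  intro y hy
  simp only [Finset.mem_insert, Finset.mem_singleton] at hy
  rcases hy with rfl | rfl | rfl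
  · exact hξ
  · exact pow_mem_primitiveRoots_seven (by norm_num) hξ
  · exact pow_mem_primitiveRoots_seven (by norm_num) hξ

/-- The residues `1, 2, 4` permute the triple, so `k` is chosen trivial on `ω` and `X`. The residues
`3, 5, 6` send it to its complement; there `k` squares `ω` and negates `X`, and the sum is preserved
by `1 + ω + ω ^ 2 = 0` and `1 + ξ + ⋯ + ξ ^ 6 = 0`. -/
theorem exists_unit_fixing_septicForm (h2 : 2 ∣ N) (hX : IsOfFinOrder X)
    (hω : IsPrimitiveRoot ω 3) (hξ : ξ ∈ primitiveRoots 7 ℂ) (h4 : 4 ∣ orderOf X)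
    (hm3 : ¬ 3 ∣ orderOf X) (hm7 : ¬ 7 ∣ orderOf X)
    (hN : ∀ y ∈ septicForm X ω {ξ, ξ ^ 2, ξ ^ 4}, y ^ N = 1) {r : ℕ} (hr0 : 0 < r) (hr : r < 7) :
    ∃ k : (ZMod N)ˣ, k.val.val ≡ r [MOD 7] ∧
      ((septicForm X ω {ξ, ξ ^ 2, ξ ^ 4}).map (· ^ k.val.val)).sum =
        (septicForm X ω {ξ, ξ ^ 2, ξ ^ 4}).sum := by
  have hX0 := isOfFinOrder_ne_zero hX
  obtain ⟨h7, h3, hXN⟩ := dvd_of_pow_septicForm_eq_one h2 hω hX0 (triple_subset hξ)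
    (by rw [card_triple hξ]; norm_num) hN
  have hmN := orderOf_dvd_of_pow_eq_one hXN
  have hξ7 := (mem_primitiveRoots_seven.1 hξ).1
  have hω3 : ω ^ 3 = 1 := hω.pow_eq_one
  have hr7 : r.Coprime 7 := ((Nat.Prime.coprime_iff_not_dvd (by norm_num)).2
    (Nat.not_dvd_of_pos_of_lt hr0 hr)).symm
  have hsum1 := sum_map_pow_septicForm (X := X) (ω := ω) (k := 1) {ξ, ξ ^ 2, ξ ^ 4}
  rw [sum_pow_triple hξ] at hsum1
  simp only [pow_one, Multiset.map_id'] at hsum1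
  have hgeomξ := ((mem_primitiveRoots (by norm_num)).1 hξ).geom_sum_eq_zero (by norm_num)
  have hgeomω := hω.geom_sum_eq_zero (by norm_num)
  simp only [Finset.sum_range_succ, Finset.sum_range_zero, pow_zero, pow_one, zero_add]
    at hgeomξ hgeomω
  by_cases hr' : r = 1 ∨ r = 2 ∨ r = 4
  · obtain ⟨k, hk7, hk3, hkm⟩ := exists_unit_modEq (N := N) (e := 1) (f := 1) hm3 hm7 hmN h3 h7 hr7
      (by norm_num) (by simp)
    refine ⟨k, hk7, ?_⟩
    have hodd := odd_val_unit h2 k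
    rw [sum_map_pow_septicForm, sum_pow_triple hξ, hsum1, mul_pow, hodd.neg_pow,
      pow_eq_pow_of_modEq hkm (pow_orderOf_eq_one X), pow_eq_pow_of_modEq hk3 hω3,
      pow_eq_pow_of_modEq hk7 hξ7, pow_one, pow_one]
    rcases hr' with rfl | rfl | rfl
    · ring
    · linear_combination X * ξ * hξ7
    · linear_combination X * (ξ + ξ ^ 9 + ξ ^ 2) * hξ7
  · obtain ⟨j, hj⟩ := h4
    -- For `X` of order `4 * j`, the exponent `1 + 2 * j` negates `X` and is prime to the order.
    have hf : (1 + 2 * j).Coprime (orderOf X) := by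
      rw [hj]
      refine Nat.Coprime.mul_right ?_ ?_
      · exact Nat.Coprime.pow_right 2 (by simp : Nat.Coprime (1 + 2 * j) 2)
      · simp
    obtain ⟨k, hk7, hk3, hkm⟩ := exists_unit_modEq (N := N) (e := 2) hm3 hm7 hmN h3 h7 hr7
      (by norm_num) hf
    refine ⟨k, hk7, ?_⟩
    have hodd := odd_val_unit h2 k
    have hXj : X ^ (2 * j) = -1 :=
      ((IsPrimitiveRoot.orderOf X).pow hX.orderOf_pos
        (by rw [hj]; ring : orderOf X = (2 * j) * 2)).eq_neg_one_of_two_right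
    rw [sum_map_pow_septicForm, sum_pow_triple hξ, hsum1, mul_pow, hodd.neg_pow,
      pow_eq_pow_of_modEq hkm (pow_orderOf_eq_one X), pow_eq_pow_of_modEq hk3 hω3,
      pow_eq_pow_of_modEq hk7 hξ7, pow_add, hXj]
    have hr'' : r = 3 ∨ r = 5 ∨ r = 6 := by omega
    rcases hr'' with rfl | rfl | rfl
    · linear_combination X * hgeomω - X * hgeomξ - X * ξ ^ 5 * hξ7
    · linear_combination X * hgeomω - X * hgeomξ - X * (ξ ^ 3 + ξ ^ 13 + ξ ^ 6) * hξ7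
    · linear_combination X * hgeomω - X * hgeomξ - X * (ξ ^ 5 + ξ ^ 17 + ξ ^ 10 + ξ ^ 3) * hξ7

end Converse

/-! ### The main theorem. -/

theorem exists_cubeRoot_of_coprime_six {c : ℕ} (hc : c.Coprime 6) :
    ∃ ω : ℂ, IsPrimitiveRoot ω 3 ∧ zeta 6 ^ c = -ω := by
  have hp : IsPrimitiveRoot (zeta 6 ^ c) 6 :=
    (zeta_isPrimitiveRoot (by norm_num)).pow_of_coprime c hc
  have h1 : (zeta 6 ^ c) ^ 3 = -1 :=
    (hp.pow (by norm_num) (by norm_num : 6 = 3 * 2)).eq_neg_one_of_two_right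
  have h4 : -zeta 6 ^ c = (zeta 6 ^ c) ^ 4 := by linear_combination -(zeta 6 ^ c) * h1
  refine ⟨-zeta 6 ^ c, ?_, (neg_neg _).symm⟩
  rw [h4, show 4 = 2 * 2 by norm_num, pow_mul]
  exact (hp.pow (by norm_num) (by norm_num : 6 = 2 * 3)).pow_of_coprime 2 (by norm_num)

theorem theorem5 (α : ℂ) (hα : IsCyclotomicInteger α) (hlen : cyclotomicLength α = 4) :
    conductorDegree α ≤ 6 ∧
      (conductorDegree α = 6 ↔
        ∃ (ε : ℂ) (c a : ℕ), IsOfFinOrder ε ∧ 4 ∣ orderOf ε ∧ ¬ 3 ∣ orderOf ε ∧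
          ¬ 7 ∣ orderOf ε ∧ c.Coprime 6 ∧ a.Coprime 7 ∧
          α = ε * (zeta 6 ^ c + zeta 7 ^ a + zeta 7 ^ (2 * a) + zeta 7 ^ (4 * a))) := by
  obtain ⟨s, hs, hc, hsα⟩ := exists_reduced_of_cyclotomicLength hα hlen
  have hcpos := (cyclotomicConductor_spec hα).1
  have h2 := two_dvd_evenLevel (cyclotomicConductor α)
  have : NeZero (evenLevel (cyclotomicConductor α)) := ⟨(evenLevel_pos hcpos).ne'⟩
  have hfaith : ∀ {t : Multiset ℂ}, Reduced t → t.sum = α →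
      ∀ k : (ZMod (evenLevel (cyclotomicConductor α)))ˣ,
      (∀ y ∈ t, y ^ k.val.val = y) → k = 1 := fun ht htα k hk => by
    have h1 := modEq_one_of_pow_eq_self hα ht htα (ZMod.val_coe_unit_coprime k) hk
    rw [← ZMod.natCast_eq_natCast_iff, ZMod.natCast_zmod_val, Nat.cast_one] at h1
    exact Units.ext h1
  have hseptic : ∀ {X ω : ℂ} {A : Finset ℂ}, Reduced (septicForm X ω A) →
      (septicForm X ω A).sum = α → X ≠ 0 → IsPrimitiveRoot ω 3 → A ⊆ primitiveRoots 7 ℂ →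
      A.card = 3 → conductorDegree α ≤ 6 := fun hr hrα hX hω hA hA3 => by
    have hN := pow_evenLevel_conductor_eq_one hα hr hrα
    obtain ⟨H, hH, hmem⟩ := exists_subgroup_card_eq_conductorDegree hα hr hrα
    obtain ⟨h7, -⟩ := dvd_of_pow_septicForm_eq_one h2 hω hX hA (by omega) hN
    have h1 := Nat.card_le_card_of_injective _ (unitsMap_seven_injective h2 hr hX hω hA hA3 hN h7
      (fun k hk => ((hmem k).1 hk).trans hrα.symm) (fun k _ => hfaith hr hrα k))
    rwa [card_units_seven, hH] at h1
  have hmain : conductorDegree α ≤ 6 ∧ (conductorDegree α = 6 →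
      ∃ (ε : ℂ) (c a : ℕ), IsOfFinOrder ε ∧ 4 ∣ orderOf ε ∧ ¬ 3 ∣ orderOf ε ∧
        ¬ 7 ∣ orderOf ε ∧ c.Coprime 6 ∧ a.Coprime 7 ∧
        α = ε * (zeta 6 ^ c + zeta 7 ^ a + zeta 7 ^ (2 * a) + zeta 7 ^ (4 * a))) := by
    have hN := pow_evenLevel_conductor_eq_one hα hs hsα
    obtain ⟨H, hH, hmem⟩ := exists_subgroup_card_eq_conductorDegree hα hs hsα
    have hsum : ∀ k ∈ H, (s.map (· ^ k.val.val)).sum = s.sum := fun k hk =>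
      ((hmem k).1 hk).trans hsα.symm
    have hred : ∀ k ∈ H, Reduced (s.map (· ^ k.val.val)) := fun k hk =>
      hs.of_card_eq (fun y hy => by
        obtain ⟨w, hw, rfl⟩ := Multiset.mem_map.1 hy
        exact (hs.1 w hw).pow) (hsum k hk) (Multiset.card_map _ _)
    by_cases hsplit : ∀ k ∈ H, ∀ x : ℂ, (s.filter fun y => y ^ 30 = x ^ 30).sum =
        ((s.map (· ^ k.val.val)).filter fun y => y ^ 30 = x ^ 30).sum
    · have h4 := card_le_four_of_splitting h2 hs hc.le hN hsum hred hsplit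
        fun k _ => hfaith hs hsα k
      rw [hH] at h4
      exact ⟨by omega, fun h => by omega⟩
    · push Not at hsplit
      obtain ⟨k, hk, x, hx⟩ := hsplit
      obtain ⟨X, ω, A, hX, hω, hA, hA3, rfl, -⟩ :=
        exists_septicForm_of_not_splitting hs (hred k hk) hc (hsum k hk).symm hx
      refine ⟨hseptic hs hsα hX hω hA hA3, fun h6 => ?_⟩
      rw [← hH] at h6
      have := exists_eq_of_card_eq_six h2 hs hX hω hA hA3 hN hsum (fun k _ => hfaith hs hsα k) h6
      rwa [hsα] at this
  refine ⟨hmain.1, hmain.2, ?_⟩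
  rintro ⟨ε, c, a, hε, h4, h3, h7, hc6, ha7, hαε⟩
  obtain ⟨ω, hω, hcω⟩ := exists_cubeRoot_of_coprime_six hc6
  have hξ : zeta 7 ^ a ∈ primitiveRoots 7 ℂ := (mem_primitiveRoots (by norm_num)).2
    ((zeta_isPrimitiveRoot (by norm_num)).pow_of_coprime a ha7)
  have hrα : (septicForm ε ω {zeta 7 ^ a, (zeta 7 ^ a) ^ 2, (zeta 7 ^ a) ^ 4}).sum = α := by
    have h1 := sum_pow_triple hξ 1
    simp only [pow_one] at h1
    rw [sum_septicForm, h1, hαε, hcω, ← pow_mul, ← pow_mul, mul_comm a 2, mul_comm a 4]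
    ring
  -- The given expression has four terms, which is the length of `α`, so it is minimal.
  have hr : Reduced (septicForm ε ω {zeta 7 ^ a, (zeta 7 ^ a) ^ 2, (zeta 7 ^ a) ^ 4}) := by
    refine hs.of_card_eq (fun y hy => ?_) (hrα.trans hsα.symm)
      (by rw [card_septicForm, card_triple hξ, hc])
    rcases Multiset.mem_cons.1 hy with rfl | hy
    · exact isOfFinOrder_mul (isOfFinOrder_neg hε)
        (isOfFinOrder_of_pow_eq_one (by norm_num) hω.pow_eq_one)
    · obtain ⟨η, hη, rfl⟩ := Multiset.mem_map.1 hy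
      exact isOfFinOrder_mul hε (isOfFinOrder_of_pow_eq_one (by norm_num)
        (mem_primitiveRoots_seven.1 (triple_subset hξ hη)).1)
  have hN := pow_evenLevel_conductor_eq_one hα hr hrα
  obtain ⟨H, hH, hmem⟩ := exists_subgroup_card_eq_conductorDegree hα hr hrα
  refine le_antisymm hmain.1 ?_
  obtain ⟨h7N, -⟩ := dvd_of_pow_septicForm_eq_one h2 hω (isOfFinOrder_ne_zero hε)
    (triple_subset hξ) (by rw [card_triple hξ]; norm_num) hN
  -- Every residue prime to `7` is realised in the stabiliser, which gives the lower bound `6`.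
  have hsurj : Function.Surjective ((ZMod.unitsMap h7N).comp H.subtype) := by
    intro u
    have hu := ZMod.val_coe_unit_coprime u
    have hupos : 0 < (u : ZMod 7).val := by
      rw [Nat.pos_iff_ne_zero]
      intro h0
      rw [h0] at hu
      norm_num at hu
    obtain ⟨k, hk7, hksum⟩ := exists_unit_fixing_septicForm h2 hε hω hξ h4 h3 h7 hN hupos
      (ZMod.val_lt _)
    refine ⟨⟨k, (hmem k).2 (hksum.trans hrα)⟩, Units.ext ?_⟩
    rw [← ZMod.natCast_eq_natCast_iff, ZMod.natCast_zmod_val] at hk7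
    simp only [MonoidHom.comp_apply, Subgroup.coe_subtype, ZMod.unitsMap_val]
    rw [← hk7, ZMod.natCast_val]
  have h1 := Nat.card_le_card_of_surjective _ hsurj
  rwa [card_units_seven, hH] at h1
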